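/- Let $M$ be an $n$-dimensional smooth Riemannian manifold with Levi-Civita connection $\nabla$ and curvature $R(X,Y)=\nabla_X\nabla_Y-\nabla_Y\nabla_X-\nabla_{[X,Y]}$. Let $\Lambda^*M=\bigoplus_{p=0}^n\Lambda^pT^*M$ be the exterior bundle with its induced connection, again denoted $\nabla$, given by $(\nabla_X\omega)(W_1,\dots,W_p)=X(\omega(W_1,\dots,W_p))-\sum_i\omega(W_1,\dots,\nabla_XW_i,\dots,W_p)$, and with induced curvature, again denoted $R(X,Y)=\nabla_X\nabla_Y-\nabla_Y\nabla_X-\nabla_{[X,Y]}$. Both curvatures are tensorial: for $x\in M$ and $u,v\in T_xM$ they determine unique endomorphisms $R(u,v)$ of $T_xM$ and of each $\Lambda^pT^*_xM$. Identify $\Lambda^*M$ with the Clifford bundle ${\rm C}\ell(M)$ (with $u\cdot u=-|u|^2$), which then acts on $\Lambda^*M$ on the left by $u\cdot\varphi=u^\flat\wedge\varphi-\iota_u\varphi$ for tangent vectors $u$. The Weitzenböck curvature operator of $\Lambda^*M$ at $x\in M$ is $$\mathcal{R}\varphi=\sum_{i<j}e_i\cdot e_j\cdot R(e_i,e_j)\varphi,\qquad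 \varphi\in\Lambda^*_xM,$$ for an orthonormal basis $e_1,\dots,e_n$ of $T_xM$. Let $s(x)=\sum_{i,j}\langle R(e_i,e_j)e_j,e_i\rangle$ be the scalar curvature. Then, at every point $x\in M$ (and for every choice of the orthonormal bases): 1. for every integer $p$ with $1\le p\le n-1$, $\mathcal{R}$ maps $\Lambda^pT^*_xM$ to itself, and its restriction $\mathcal{R}_p$ to $p$-forms satisfies $$\operatorname{tr}\mathcal{R}_p=\binom{n-2}{p-1}\,s(x);$$ 2. the trace of the total Weitzenböck operator on $\Lambda^*_xM$ is $$\operatorname{tr}\mathcal{R}=2^{\,n-2}\,s(x).$$ -/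

import Mathlib

open scoped Manifold ContDiff Bundle

namespace WeitzenbockTrace

/-! ### Exterior forms on a Euclidean vector space as a Clifford module -/

section Algebra

/-- The space `Λᵖ V*` of alternating `p`-forms on `V`. -/
abbrev PForm (V : Type*) [AddCommGroup V] [Module ℝ V] (p : ℕ) : Type _ := V [⋀^Fin p]→ₗ[ℝ] ℝ

/-- The exterior algebra `Λ V* = ⨁ₚ Λᵖ V*`. When `V` is finite-dimensional, all but finitely many
factors vanish, so that the product below is the direct sum. -/
abbrev ExteriorForms (V : Type*) [AddCommGroup V] [Module ℝ V] : Type _ := (p : ℕ) → PForm V p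

variable {V : Type*} [NormedAddCommGroup V] [InnerProductSpace ℝ V]

/-- Exterior multiplication `φ ↦ u♭ ∧ φ`, where `u♭ = ⟨u, ·⟩`, i.e.
`(u♭ ∧ φ)(v₀, …, vₚ) = ∑ᵢ (-1)ⁱ ⟨u, vᵢ⟩ φ(v₀, …, v̂ᵢ, …, vₚ)`. -/
noncomputable def wedgeL (u : V) (p : ℕ) : PForm V p →ₗ[ℝ] PForm V (p + 1) where
  toFun φ := AlternatingMap.alternatizeUncurryFin ((innerₗ V u).smulRight φ)
  map_add' φ ψ := by
    rw [← AlternatingMap.alternatizeUncurryFin_add]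
    congr 1
    ext v w
    simp
  map_smul' c φ := by
    rw [RingHom.id_apply, ← AlternatingMap.alternatizeUncurryFin_smul]
    congr 1
    ext v w
    simp only [LinearMap.smulRight_apply, LinearMap.smul_apply, AlternatingMap.smul_apply,
      smul_eq_mul]
    ring

/-- Interior multiplication `φ ↦ u ⌟ φ = φ(u, ·, …, ·)`. -/
def contractL (u : V) (p : ℕ) : PForm V (p + 1) →ₗ[ℝ] PForm V p where
  toFun φ := φ.curryLeft u
  map_add' φ ψ := by simp
  map_smul' c φ := by simp

/-- Clifford multiplication by a vector on the exterior algebra, `u · φ = u♭ ∧ φ - u ⌟ φ`. -/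
noncomputable def cliffordMul (u : V) : ExteriorForms V →ₗ[ℝ] ExteriorForms V :=
  LinearMap.pi fun p ↦
    match p with
    | 0 => -(contractL u 0 ∘ₗ LinearMap.proj 1)
    | q + 1 => wedgeL u q ∘ₗ LinearMap.proj q - contractL u (q + 1) ∘ₗ LinearMap.proj (q + 2)

lemma wedgeL_apply (u : V) (p : ℕ) (φ : PForm V p) (v : Fin (p + 1) → V) :
    wedgeL u p φ v = ∑ i : Fin (p + 1), (-1) ^ (i : ℕ) * (inner ℝ u (v i) * φ (i.removeNth v)) := by
  change AlternatingMap.alternatizeUncurryFin ((innerₗ V u).smulRight φ) v = _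
  rw [AlternatingMap.alternatizeUncurryFin_apply]
  simp

lemma contractL_apply (u : V) (p : ℕ) (φ : PForm V (p + 1)) (v : Fin p → V) :
    contractL u p φ v = φ (Matrix.vecCons u v) := rfl

lemma contractL_wedgeL (u : V) (p : ℕ) (φ : PForm V (p + 1)) :
    contractL u (p + 1) (wedgeL u (p + 1) φ) + wedgeL u p (contractL u p φ) = ‖u‖ ^ 2 • φ := by
  ext w
  rw [AlternatingMap.add_apply, contractL_apply, wedgeL_apply, wedgeL_apply, Fin.sum_univ_succ]
  have h (i : Fin (p + 1)) : i.succ.removeNth (Matrix.vecCons u w) =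
      Matrix.vecCons u (i.removeNth w) := by
    ext j
    refine Fin.cases ?_ (fun k ↦ ?_) j <;> simp [Fin.removeNth]
  have h0 : (0 : Fin (p + 2)).removeNth (Matrix.vecCons u w) = w := by
    ext j
    simp [Fin.removeNth]
  simp [h, h0, contractL_apply, pow_succ]

lemma contractL_wedgeL_zero (u : V) (φ : PForm V 0) :
    contractL u 0 (wedgeL u 0 φ) = ‖u‖ ^ 2 • φ := by
  ext w
  rw [contractL_apply, wedgeL_apply]
  simp only [Fin.sum_univ_succ, Finset.univ_eq_empty, Finset.sum_empty]
  have h0 : (0 : Fin 1).removeNth (Matrix.vecCons u w) = w := Subsingleton.elim _ _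
  simp [h0]

lemma wedgeL_wedgeL (u : V) (p : ℕ) (φ : PForm V p) : wedgeL u (p + 1) (wedgeL u p φ) = 0 := by
  have h : (innerₗ V u).smulRight (AlternatingMap.alternatizeUncurryFin
      ((innerₗ V u).smulRight φ)) = AlternatingMap.alternatizeUncurryFinLM ∘ₗ
        (innerₗ V u).smulRight ((innerₗ V u).smulRight φ) := by
    ext v w
    simp only [LinearMap.smulRight_apply, LinearMap.comp_apply, map_smul,
      AlternatingMap.alternatizeUncurryFinLM_apply]
  change AlternatingMap.alternatizeUncurryFin ((innerₗ V u).smulRight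
    (AlternatingMap.alternatizeUncurryFin ((innerₗ V u).smulRight φ))) = 0
  rw [h]
  refine AlternatingMap.alternatizeUncurryFin_alternatizeUncurryFinLM_comp_of_symmetric
    fun x y ↦ ?_
  ext v
  simp only [LinearMap.smulRight_apply, LinearMap.smul_apply, AlternatingMap.smul_apply,
    smul_eq_mul]
  ring

lemma contractL_contractL (u : V) (p : ℕ) (φ : PForm V (p + 2)) :
    contractL u p (contractL u (p + 1) φ) = 0 :=
  AlternatingMap.curryLeft_same φ u

lemma cliffordMul_cliffordMul (u : V) (σ : ExteriorForms V) :
    cliffordMul u (cliffordMul u σ) = -(‖u‖ ^ 2 • σ) := by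
  funext p
  match p with
  | 0 =>
    change -(contractL u 0 (wedgeL u 0 (σ 0) - contractL u 1 (σ 2))) = -(‖u‖ ^ 2 • σ 0)
    rw [map_sub, contractL_wedgeL_zero, contractL_contractL, sub_zero]
  | 1 =>
    change wedgeL u 0 (-(contractL u 0 (σ 1))) -
      contractL u 1 (wedgeL u 1 (σ 1) - contractL u 2 (σ 3)) = -(‖u‖ ^ 2 • σ 1)
    rw [map_sub, contractL_contractL, map_neg, ← contractL_wedgeL]
    abel
  | q + 2 =>
    change wedgeL u (q + 1) (wedgeL u q (σ q) - contractL u (q + 1) (σ (q + 2))) -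
      contractL u (q + 2) (wedgeL u (q + 2) (σ (q + 2)) - contractL u (q + 3) (σ (q + 4))) =
        -(‖u‖ ^ 2 • σ (q + 2))
    rw [map_sub, map_sub, contractL_contractL, wedgeL_wedgeL, ← contractL_wedgeL]
    abel

lemma wedgeL_add (u v : V) (p : ℕ) : wedgeL (u + v) p = wedgeL u p + wedgeL v p := by
  ext φ w
  simp only [LinearMap.add_apply, AlternatingMap.add_apply, wedgeL_apply, inner_add_left, add_mul,
    mul_add, Finset.sum_add_distrib]

lemma wedgeL_smul (c : ℝ) (u : V) (p : ℕ) : wedgeL (c • u) p = c • wedgeL u p := by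
  ext φ w
  simp only [LinearMap.smul_apply, AlternatingMap.smul_apply, wedgeL_apply, real_inner_smul_left,
    smul_eq_mul, Finset.mul_sum]
  refine Finset.sum_congr rfl fun i _ ↦ ?_
  ring

lemma contractL_add (u v : V) (p : ℕ) : contractL (u + v) p = contractL u p + contractL v p :=
  LinearMap.ext fun φ ↦ map_add φ.curryLeft u v

lemma contractL_smul (c : ℝ) (u : V) (p : ℕ) : contractL (c • u) p = c • contractL u p :=
  LinearMap.ext fun φ ↦ map_smul φ.curryLeft c u

/-- Clifford multiplication, as a linear map in the vector. -/
noncomputable def cliffordMulL (V : Type*) [NormedAddCommGroup V] [InnerProductSpace ℝ V] :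
    V →ₗ[ℝ] Module.End ℝ (ExteriorForms V) where
  toFun := cliffordMul
  map_add' u v := by
    refine LinearMap.ext fun σ ↦ funext fun p ↦ ?_
    match p with
    | 0 =>
      change -(contractL (u + v) 0 (σ 1)) = -(contractL u 0 (σ 1)) + -(contractL v 0 (σ 1))
      rw [contractL_add, LinearMap.add_apply, neg_add]
    | q + 1 =>
      change wedgeL (u + v) q (σ q) - contractL (u + v) (q + 1) (σ (q + 2)) =
        wedgeL u q (σ q) - contractL u (q + 1) (σ (q + 2)) +
          (wedgeL v q (σ q) - contractL v (q + 1) (σ (q + 2)))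
      rw [contractL_add, wedgeL_add, LinearMap.add_apply, LinearMap.add_apply]
      abel
  map_smul' c u := by
    refine LinearMap.ext fun σ ↦ funext fun p ↦ ?_
    match p with
    | 0 =>
      change -(contractL (c • u) 0 (σ 1)) = c • -(contractL u 0 (σ 1))
      rw [contractL_smul, LinearMap.smul_apply, smul_neg]
    | q + 1 =>
      change wedgeL (c • u) q (σ q) - contractL (c • u) (q + 1) (σ (q + 2)) =
        c • (wedgeL u q (σ q) - contractL u (q + 1) (σ (q + 2)))
      rw [contractL_smul, wedgeL_smul, LinearMap.smul_apply, LinearMap.smul_apply, smul_sub]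

/-- The quadratic form `u ↦ -|u|²` defining the Clifford algebra `Cℓ(V)`, so `u · u = -|u|²`. -/
noncomputable def cliffordForm (V : Type*) [NormedAddCommGroup V] [InnerProductSpace ℝ V] :
    QuadraticForm ℝ V := -LinearMap.BilinMap.toQuadraticMap (innerₗ V)

/-- The left `Cℓ(V)`-module structure of the exterior algebra of `V`. -/
noncomputable def cliffordAction (V : Type*) [NormedAddCommGroup V] [InnerProductSpace ℝ V] :
    CliffordAlgebra (cliffordForm V) →ₐ[ℝ] Module.End ℝ (ExteriorForms V) :=
  CliffordAlgebra.lift (cliffordForm V) ⟨cliffordMulL V, fun u ↦ by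
    ext σ : 1
    change cliffordMul u (cliffordMul u σ) = (-inner ℝ u u : ℝ) • σ
    rw [cliffordMul_cliffordMul, real_inner_self_eq_norm_sq]
    exact (neg_smul _ _).symm⟩

end Algebra

/-! ### Vector fields, forms, connections and curvature -/

section Manifold

variable {n : ℕ} {M : Type*} [TopologicalSpace M] [ChartedSpace (EuclideanSpace ℝ (Fin n)) M]
  [IsManifold (𝓡 n) ∞ M]

variable (n M) in
/-- (Not necessarily smooth) vector fields on `M`. -/
abbrev VField : Type _ := Π x : M, TangentSpace (𝓡 n) x

/-- The vector field `X` is smooth. -/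
def VField.IsSmooth (X : VField n M) : Prop :=
  ContMDiff (𝓡 n) (𝓡 n).tangent ∞ (fun x ↦ (⟨x, X x⟩ : TangentBundle (𝓡 n) M))

variable (n M) in
/-- Connections on the tangent bundle of `M`; in Mathlib's notation, `∇_X Y` at `x` is
`cov Y x (X x)`. -/
abbrev Connection : Type _ :=
  CovariantDerivative (𝓡 n) (EuclideanSpace ℝ (Fin n)) (fun x : M ↦ TangentSpace (𝓡 n) x)

/-- The curvature `R(X, Y) Z = ∇_X ∇_Y Z - ∇_Y ∇_X Z - ∇_[X, Y] Z` of a connection on `TM`. -/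
noncomputable def curvVF (cov : Connection n M) (X Y Z : VField n M) : VField n M := fun x ↦
  cov (fun y ↦ cov Z y (Y y)) x (X x) - cov (fun y ↦ cov Z y (X y)) x (Y x) -
    cov Z x (VectorField.mlieBracket (𝓡 n) X Y x)

/-- `L` is the endomorphism `R(u, v)` of `TₓM`: `R(u, v) Zₓ = (R(X, Y) Z)ₓ` for all smooth vector
fields `X`, `Y`, `Z` with `Xₓ = u` and `Yₓ = v`. -/
def IsCurvature (cov : Connection n M) {x : M} (u v : TangentSpace (𝓡 n) x)
    (L : TangentSpace (𝓡 n) x →ₗ[ℝ] TangentSpace (𝓡 n) x) : Prop :=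
  ∀ X Y Z : VField n M, X.IsSmooth → Y.IsSmooth → Z.IsSmooth → X x = u → Y x = v →
    L (Z x) = curvVF cov X Y Z x

/-- The curvature endomorphism `R(u, v)` of `TₓM`. -/
noncomputable def curvature (cov : Connection n M) {x : M} (u v : TangentSpace (𝓡 n) x) :
    TangentSpace (𝓡 n) x →ₗ[ℝ] TangentSpace (𝓡 n) x :=
  Classical.epsilon (IsCurvature cov u v)

variable (n M) in
/-- Sections of `Λᵖ T*M`, i.e. (not necessarily smooth) differential `p`-forms on `M`. -/
abbrev DForm (p : ℕ) : Type _ := Π x : M, PForm (TangentSpace (𝓡 n) x) p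

/-- A differential form as a function on vector fields, `(W₁, …, W_p) ↦ η(W₁, …, W_p)`. -/
noncomputable def DForm.eval {p : ℕ} (η : DForm n M p) (W : Fin p → VField n M) : M → ℝ :=
  fun x ↦ η x fun i ↦ W i x

/-- The form `η` is smooth, i.e. `η(W₁, …, W_p)` is a smooth function for all smooth vector fields
`W₁, …, W_p`. -/
def DForm.IsSmooth {p : ℕ} (η : DForm n M p) : Prop :=
  ∀ W : Fin p → VField n M, (∀ i, (W i).IsSmooth) → ContMDiff (𝓡 n) 𝓘(ℝ) ∞ (η.eval W)

/-- The connection induced on `p`-forms, where a form is considered as a function on vector fields: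
`(∇_X Ω)(W₁, …, W_p) = X(Ω(W₁, …, W_p)) - ∑ᵢ Ω(W₁, …, ∇_X Wᵢ, …, W_p)`. -/
noncomputable def covForm (cov : Connection n M) {p : ℕ} (X : VField n M)
    (Ω : (Fin p → VField n M) → M → ℝ) : (Fin p → VField n M) → M → ℝ := fun W x ↦
  mvfderiv (𝓡 n) (Ω W) x (X x) -
    ∑ i, Ω (Function.update W i fun y ↦ cov (W i) y (X y)) x

/-- The curvature `R(X, Y) Ω = ∇_X ∇_Y Ω - ∇_Y ∇_X Ω - ∇_[X, Y] Ω` of the connection induced on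
`p`-forms. -/
noncomputable def curvForm (cov : Connection n M) {p : ℕ} (X Y : VField n M)
    (Ω : (Fin p → VField n M) → M → ℝ) : (Fin p → VField n M) → M → ℝ := fun W x ↦
  covForm cov X (covForm cov Y Ω) W x - covForm cov Y (covForm cov X Ω) W x -
    covForm cov (VectorField.mlieBracket (𝓡 n) X Y) Ω W x

/-- `L` is the endomorphism `R(u, v)` of `Λᵖ Tₓ*M`: `R(u, v) ηₓ = (R(X, Y) η)ₓ` for all smooth
forms `η` and all smooth vector fields `X`, `Y` with `Xₓ = u` and `Yₓ = v`. -/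
def IsFormCurvature (cov : Connection n M) (p : ℕ) {x : M} (u v : TangentSpace (𝓡 n) x)
    (L : PForm (TangentSpace (𝓡 n) x) p →ₗ[ℝ] PForm (TangentSpace (𝓡 n) x) p) : Prop :=
  ∀ (X Y : VField n M) (η : DForm n M p) (W : Fin p → VField n M),
    X.IsSmooth → Y.IsSmooth → η.IsSmooth → (∀ i, (W i).IsSmooth) → X x = u → Y x = v →
      L (η x) (fun i ↦ W i x) = curvForm cov X Y η.eval W x

/-- The curvature endomorphism `R(u, v)` of `Λᵖ Tₓ*M`. -/
noncomputable def formCurvature (cov : Connection n M) (p : ℕ) {x : M}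
    (u v : TangentSpace (𝓡 n) x) :
    PForm (TangentSpace (𝓡 n) x) p →ₗ[ℝ] PForm (TangentSpace (𝓡 n) x) p :=
  Classical.epsilon (IsFormCurvature cov p u v)

/-- The curvature endomorphism `R(u, v)` of the exterior bundle `Λ T*M = ⨁ₚ Λᵖ T*M` at `x`. -/
noncomputable def exteriorCurvature (cov : Connection n M) {x : M} (u v : TangentSpace (𝓡 n) x) :
    Module.End ℝ (ExteriorForms (TangentSpace (𝓡 n) x)) :=
  LinearMap.pi fun p ↦ formCurvature cov p u v ∘ₗ LinearMap.proj p

variable [Bundle.RiemannianBundle (fun x : M ↦ TangentSpace (𝓡 n) x)]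

/-- A shortcut for instance search. -/
instance instRiemannianOne [h : IsContMDiffRiemannianBundle (𝓡 n) ∞ (EuclideanSpace ℝ (Fin n))
    (fun x : M ↦ TangentSpace (𝓡 n) x)] :
    IsContMDiffRiemannianBundle (𝓡 n) 1 (EuclideanSpace ℝ (Fin n))
      (fun x : M ↦ TangentSpace (𝓡 n) x) :=
  h.of_le (by norm_num)

/-- The smooth connection `cov` is the Levi-Civita connection of the Riemannian manifold `M`. -/
structure IsLeviCivita [IsContMDiffRiemannianBundle (𝓡 n) ∞ (EuclideanSpace ℝ (Fin n))
    (fun x : M ↦ TangentSpace (𝓡 n) x)] (cov : Connection n M) : Prop where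
  smooth : cov.ContMDiffCovariantDerivative ∞
  metric : cov.IsMetricCompatible
  torsion : cov.torsion = 0

/-- The Weitzenböck curvature operator `∑_{i < j} eᵢ · eⱼ · R(eᵢ, eⱼ)` of the exterior bundle at
`x`, for an orthonormal basis `e` of `TₓM`. -/
noncomputable def weitzenbock (cov : Connection n M) {x : M}
    (e : OrthonormalBasis (Fin n) ℝ (TangentSpace (𝓡 n) x)) :
    Module.End ℝ (ExteriorForms (TangentSpace (𝓡 n) x)) :=
  ∑ i, ∑ j ∈ Finset.Ioi i,
    cliffordAction _ (CliffordAlgebra.ι _ (e i) * CliffordAlgebra.ι _ (e j)) *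
      exteriorCurvature cov (e i) (e j)

/-- The scalar curvature `∑_{i, j} ⟨R(eᵢ, eⱼ) eⱼ, eᵢ⟩` at `x`, for an orthonormal basis `e` of
`TₓM`. -/
noncomputable def scalarCurvature (cov : Connection n M) {x : M}
    (e : OrthonormalBasis (Fin n) ℝ (TangentSpace (𝓡 n) x)) : ℝ :=
  ∑ i, ∑ j, inner ℝ (curvature cov (e i) (e j) (e j)) (e i)

end Manifold

end WeitzenbockTrace

/-! Write E_i and I_i for exterior and interior multiplication by e_i, and R_ijkl = ⟨R(e_i, e_j)
e_k, e_l⟩. The E_i anticommute, the I_i anticommute, and I_i E_j + E_j I_i = δ_ij. Clifford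
multiplication is E_i - I_i, and R(e_i, e_j) acts on forms as ∑ R_ijkl E_l I_k. The sum over i < j
is half the sum over all i, j. In the expansion the EE terms cancel by the Bianchi identity, the II
terms by Bianchi and the symmetry of the Ricci tensor, and the two mixed terms agree. What remains
is -∑ R_ijkl E_i I_j E_l I_k (`sum_clifford_curvature`), which preserves degree.

For the traces, cyclicity turns a product beginning with E on (p+1)-forms into one ending with E on
p-forms, and the anticommutation relations restore the original shape. Pascal's rule solves the
recursion: on (p+1)-forms, E_a I_b E_c I_d has trace ⟨a,d⟩⟨c,b⟩ C(n-2, p) + ⟨a,b⟩⟨c,d⟩ β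
(`trace_wedgeContract_mul`). Paired with R, the β term dies because R_iikl = 0, and the other gives
-∑ R_ijij = s. Summing the binomials over all degrees gives 2^(n-2).

The geometric input is that curvature is a tensor with the Riemannian symmetries
(`exists_curvVF_eq`, `IsLeviCivita.isCurvatureTensor`), and that on forms it is minus the derivation
extending it (`curvForm_eq`). Cut-off frames reduce these statements to a point. -/

namespace WeitzenbockTrace

/-! ### Wedge and contraction: anticommutation relations and derivations. -/

section ExteriorAlgebra

variable {V : Type*} [NormedAddCommGroup V] [InnerProductSpace ℝ V]

lemma contractL_wedgeL_add (u v : V) (p : ℕ) (φ : PForm V (p + 1)) :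
    contractL u (p + 1) (wedgeL v (p + 1) φ) + wedgeL v p (contractL u p φ) = inner ℝ v u • φ := by
  ext w
  rw [AlternatingMap.add_apply, contractL_apply, wedgeL_apply, wedgeL_apply, Fin.sum_univ_succ]
  have h (i : Fin (p + 1)) : i.succ.removeNth (Matrix.vecCons u w) =
      Matrix.vecCons u (i.removeNth w) := by
    ext j
    refine Fin.cases ?_ (fun k ↦ ?_) j <;> simp [Fin.removeNth]
  have h0 : (0 : Fin (p + 2)).removeNth (Matrix.vecCons u w) = w := by
    ext j
    simp [Fin.removeNth]
  simp [h, h0, contractL_apply, pow_succ]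

lemma contractL_wedgeL_of_zero (u v : V) (φ : PForm V 0) :
    contractL u 0 (wedgeL v 0 φ) = inner ℝ v u • φ := by
  ext w
  rw [contractL_apply, wedgeL_apply]
  simp only [Fin.sum_univ_succ, Finset.univ_eq_empty, Finset.sum_empty]
  have h0 : (0 : Fin 1).removeNth (Matrix.vecCons u w) = w := Subsingleton.elim _ _
  simp [h0]

/-- Exterior multiplication by `u♭` on the whole exterior algebra. -/
noncomputable def wedge (u : V) : Module.End ℝ (ExteriorForms V) :=
  LinearMap.pi fun p ↦
    match p with
    | 0 => 0
    | q + 1 => wedgeL u q ∘ₗ LinearMap.proj q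

/-- Interior multiplication by `u` on the whole exterior algebra. -/
def contract (u : V) : Module.End ℝ (ExteriorForms V) :=
  LinearMap.pi fun p ↦ contractL u p ∘ₗ LinearMap.proj (p + 1)

@[simp] lemma wedge_apply_zero (u : V) (σ : ExteriorForms V) : wedge u σ 0 = 0 := rfl

@[simp] lemma wedge_apply_succ (u : V) (σ : ExteriorForms V) (p : ℕ) :
    wedge u σ (p + 1) = wedgeL u p (σ p) := rfl

@[simp] lemma contract_apply (u : V) (σ : ExteriorForms V) (p : ℕ) :
    contract u σ p = contractL u p (σ (p + 1)) := rfl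

lemma cliffordMul_add_contract (u : V) : cliffordMul u + contract u = wedge u := by
  refine LinearMap.ext fun σ ↦ funext fun p ↦ ?_
  match p with
  | 0 => exact neg_add_cancel _
  | q + 1 => exact sub_add_cancel _ _

lemma wedge_add (u v : V) : wedge (u + v) = wedge u + wedge v := by
  refine LinearMap.ext fun σ ↦ funext fun p ↦ ?_
  match p with
  | 0 => exact (add_zero _).symm
  | q + 1 => simp [wedgeL_add]

lemma wedge_smul (c : ℝ) (u : V) : wedge (c • u) = c • wedge u := by
  refine LinearMap.ext fun σ ↦ funext fun p ↦ ?_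
  match p with
  | 0 => exact (smul_zero c).symm
  | q + 1 => simp [wedgeL_smul]

lemma contract_add (u v : V) : contract (u + v) = contract u + contract v := by
  refine LinearMap.ext fun σ ↦ funext fun p ↦ ?_
  simp [contractL_add]

lemma wedge_sum {ι : Type*} (s : Finset ι) (c : ι → ℝ) (u : ι → V) :
    wedge (∑ i ∈ s, c i • u i) = ∑ i ∈ s, c i • wedge (u i) := by
  classical
  induction s using Finset.induction_on with
  | empty => simpa using wedge_smul (0 : ℝ) (0 : V)
  | insert a s ha ih => rw [Finset.sum_insert ha, Finset.sum_insert ha, wedge_add, wedge_smul, ih]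

lemma wedge_mul_self (u : V) : wedge u * wedge u = 0 := by
  refine LinearMap.ext fun σ ↦ funext fun p ↦ ?_
  match p with
  | 0 => rfl
  | 1 => simp
  | q + 2 => exact wedgeL_wedgeL u q (σ q)

lemma contract_mul_self (u : V) : contract u * contract u = 0 := by
  refine LinearMap.ext fun σ ↦ funext fun p ↦ ?_
  exact contractL_contractL u p _

lemma wedge_mul_wedge_add (u v : V) : wedge u * wedge v + wedge v * wedge u = 0 := by
  have h := wedge_mul_self (u + v)
  rw [wedge_add, add_mul, mul_add, mul_add, wedge_mul_self, wedge_mul_self] at h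
  simpa using h

lemma contract_mul_contract_add (u v : V) :
    contract u * contract v + contract v * contract u = 0 := by
  have h := contract_mul_self (u + v)
  rw [contract_add, add_mul, mul_add, mul_add, contract_mul_self, contract_mul_self] at h
  simpa using h

lemma contract_mul_wedge_add (u v : V) :
    contract u * wedge v + wedge v * contract u =
      inner ℝ v u • (1 : Module.End ℝ (ExteriorForms V)) := by
  refine LinearMap.ext fun σ ↦ funext fun p ↦ ?_
  match p with
  | 0 =>
    change contractL u 0 (wedgeL v 0 (σ 0)) + 0 = _
    rw [contractL_wedgeL_of_zero, add_zero]
    rfl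
  | q + 1 => exact contractL_wedgeL_add u v q (σ (q + 1))

/-- The degree-preserving operator `φ ↦ u♭ ∧ (v ⌟ φ)` on `p`-forms. -/
noncomputable def wedgeContract (u v : V) : (p : ℕ) → Module.End ℝ (PForm V p)
  | 0 => 0
  | p + 1 => wedgeL u p ∘ₗ contractL v p

lemma wedge_mul_contract_apply (u v : V) (σ : ExteriorForms V) (p : ℕ) :
    (wedge u * contract v) σ p = wedgeContract u v p (σ p) := by
  match p with
  | 0 => rfl
  | q + 1 => rfl

/-- The expression of the derivation `φ ↦ ∑ₖ φ(…, A wₖ, …)` in an orthonormal basis, where `B` is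
the adjoint of `A`. -/
lemma sum_wedgeContract_apply {ι : Type*} [Fintype ι] (e : OrthonormalBasis ι ℝ V)
    (A B : V →ₗ[ℝ] V)
    (hAB : ∀ v w, inner ℝ (B v) w = inner ℝ v (A w)) (p : ℕ) (φ : PForm V p) (w : Fin p → V) :
    (∑ i, wedgeContract (B (e i)) (e i) p) φ w = ∑ k, φ (Function.update w k (A (w k))) := by
  match p with
  | 0 => simp [wedgeContract]
  | p + 1 =>
    -- Moving slot k to the front costs (-1)^k, the sign in the wedge formula; it remains to expand
    -- `A (w k)` in the basis.
    have h1 (k : Fin (p + 1)) : φ (Function.update w k (A (w k))) =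
        (-1) ^ (k : ℕ) * φ (Matrix.vecCons (A (w k)) (k.removeNth w)) := by
      rw [← Fin.insertNth_removeNth, AlternatingMap.map_insertNth]
      simp
    have hs (ψ : V →ₗ[ℝ] ℝ) (v : V) : ψ v = ∑ i, inner ℝ (e i) v * ψ (e i) := by
      conv_lhs => rw [← e.sum_repr' v, map_sum]
      simp
    have h2 (v : V) (m : Fin p → V) : φ (Matrix.vecCons (A v) m) =
        ∑ i, inner ℝ (e i) (A v) * φ (Matrix.vecCons (e i) m) := by
      let ψ : V →ₗ[ℝ] ℝ :=
        { toFun := fun x ↦ φ (Matrix.vecCons x m)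
          map_add' := fun x y ↦ φ.map_vecCons_add m x y
          map_smul' := fun c x ↦ φ.map_vecCons_smul m c x }
      exact hs ψ (A v)
    have h4 : (∑ i, wedgeContract (B (e i)) (e i) (p + 1)) φ w =
        ∑ i, wedgeL (B (e i)) p (contractL (e i) p φ) w := by
      rw [LinearMap.sum_apply]
      exact map_sum (⟨⟨fun η ↦ η w, rfl⟩, fun _ _ ↦ rfl⟩ : PForm V (p + 1) →+ ℝ) _ _
    rw [h4]
    simp only [wedgeL_apply, contractL_apply, h1, h2, hAB, Finset.mul_sum]
    rw [Finset.sum_comm]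

/-- The derivation extending the identity counts the slots of a form. Its trace is what determines
the dimensions of the spaces of forms. -/
lemma sum_wedgeContract_self {ι : Type*} [Fintype ι] (e : OrthonormalBasis ι ℝ V) (p : ℕ) :
    ∑ i, wedgeContract (e i) (e i) p = (p : ℝ) • (1 : Module.End ℝ (PForm V p)) := by
  ext φ w
  have h := sum_wedgeContract_apply e LinearMap.id LinearMap.id (fun _ _ ↦ rfl) p φ w
  simpa using h

lemma contractL_comp_wedgeL_add (u v : V) (p : ℕ) :
    contractL u p ∘ₗ wedgeL v p + wedgeContract v u p =
      inner ℝ v u • (1 : Module.End ℝ (PForm V p)) := by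
  match p with
  | 0 =>
    ext1 φ
    change contractL u 0 (wedgeL v 0 φ) + 0 = _
    rw [contractL_wedgeL_of_zero, add_zero]
    rfl
  | q + 1 => exact LinearMap.ext fun φ ↦ contractL_wedgeL_add u v q φ

end ExteriorAlgebra

/-! ### Traces on spaces of forms. -/

section Trace

variable {V : Type*} [NormedAddCommGroup V] [InnerProductSpace ℝ V] [FiniteDimensional ℝ V]

instance finite_pForm (p : ℕ) : Module.Finite ℝ (PForm V p) :=
  Module.Finite.of_injective
    (AlternatingMap.toMultilinearMapLM (R := ℝ) (S := ℝ) (M := V) (N := ℝ) (ι := Fin p))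
    AlternatingMap.coe_multilinearMap_injective

/-- Cyclicity of the trace passes from E_u I_v on (p+1)-forms to I_v E_u on p-forms, and
anticommutation reverses the order again. -/
lemma trace_wedgeContract_succ (u v : V) (p : ℕ) :
    LinearMap.trace ℝ _ (wedgeContract u v (p + 1)) =
      inner ℝ u v * LinearMap.trace ℝ _ (1 : Module.End ℝ (PForm V p)) -
        LinearMap.trace ℝ _ (wedgeContract u v p) := by
  have h := congrArg (LinearMap.trace ℝ _) (contractL_comp_wedgeL_add v u p)
  rw [map_add, map_smul, smul_eq_mul] at h
  rw [wedgeContract, LinearMap.trace_comp_comm', ← h, add_sub_cancel_right]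

lemma exists_trace_wedgeContract (p : ℕ) : ∃ τ : ℝ,
    (∀ u v : V, LinearMap.trace ℝ _ (wedgeContract u v p) = inner ℝ u v * τ) ∧
    Module.finrank ℝ V * τ = p * LinearMap.trace ℝ _ (1 : Module.End ℝ (PForm V p)) := by
  have h : ∃ τ : ℝ, ∀ u v : V, LinearMap.trace ℝ _ (wedgeContract u v p) = inner ℝ u v * τ := by
    induction p with
    | zero => exact ⟨0, by simp [wedgeContract]⟩
    | succ p ih =>
      obtain ⟨τ, h⟩ := ih
      refine ⟨LinearMap.trace ℝ _ (1 : Module.End ℝ (PForm V p)) - τ, fun u v ↦ ?_⟩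
      rw [trace_wedgeContract_succ, h]
      ring
  obtain ⟨τ, h⟩ := h
  refine ⟨τ, h, ?_⟩
  have h1 := congrArg (LinearMap.trace ℝ _) (sum_wedgeContract_self (stdOrthonormalBasis ℝ V) p)
  rw [map_sum, map_smul, smul_eq_mul] at h1
  rw [← h1]
  simp [h]

/-- Taking the trace of the counting operator in degrees p and p+1 gives (p+1) d_{p+1} = (n-p) d_p
for the dimensions d_p, the recursion of the binomial coefficients. -/
lemma trace_one_pForm (p : ℕ) :
    LinearMap.trace ℝ _ (1 : Module.End ℝ (PForm V p)) = (Module.finrank ℝ V).choose p := by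
  induction p with
  | zero =>
    rw [LinearMap.trace_one, (AlternatingMap.constLinearEquivOfIsEmpty (R' := ℝ) (M'' := V)
      (N'' := ℝ) (ι := Fin 0)).symm.finrank_eq]
    simp
  | succ p ih =>
    obtain ⟨τ, h1, h2⟩ := exists_trace_wedgeContract (V := V) p
    have h3 := congrArg (LinearMap.trace ℝ _)
      (sum_wedgeContract_self (stdOrthonormalBasis ℝ V) (p + 1))
    rw [map_sum, map_smul, smul_eq_mul] at h3
    simp only [trace_wedgeContract_succ, h1, inner_self_eq_norm_sq_to_K,
      OrthonormalBasis.norm_eq_one] at h3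
    simp only [RCLike.ofReal_real_eq_id, id_eq, one_pow, one_mul, Finset.sum_const,
      Finset.card_univ, Fintype.card_fin, nsmul_eq_mul] at h3
    rw [mul_sub, h2, ih] at h3
    have h4 : ((Module.finrank ℝ V).choose (p + 1) : ℝ) * (p + 1) =
        (Module.finrank ℝ V).choose p * (Module.finrank ℝ V - p) := by
      rcases le_or_gt p (Module.finrank ℝ V) with hp | hp
      · have := Nat.choose_succ_right_eq (Module.finrank ℝ V) p
        rw [← Nat.cast_sub hp]
        exact_mod_cast this
      · rw [Nat.choose_eq_zero_of_lt hp, Nat.choose_eq_zero_of_lt (by omega)]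
        simp
    have h5 : ((p + 1 : ℕ) : ℝ) ≠ 0 := by positivity
    push_cast at h3 h5
    apply mul_left_cancel₀ h5
    linarith

lemma trace_wedgeContract (hV : 1 ≤ Module.finrank ℝ V) (u v : V) (p : ℕ) :
    LinearMap.trace ℝ _ (wedgeContract u v (p + 1)) =
      inner ℝ u v * ((Module.finrank ℝ V - 1).choose p : ℝ) := by
  induction p with
  | zero => rw [trace_wedgeContract_succ, trace_one_pForm]; simp [wedgeContract]
  | succ p ih =>
    rw [trace_wedgeContract_succ, trace_one_pForm, ih]
    obtain ⟨m, hm⟩ := Nat.exists_eq_add_of_le' hV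
    rw [hm, Nat.add_sub_cancel, Nat.choose_succ_succ']
    push_cast
    ring

lemma mul_add_smul_add_smul {A : Type*} [Ring A] [Algebra ℝ A] {X Y N N' : A} {s t : ℝ}
    (hX : X + N = s • 1) (hY : Y + N' = t • 1) :
    X * Y + s • N' + t • N = (s * t) • (1 : A) + N * N' := by
  rw [eq_sub_of_add_eq hX, eq_sub_of_add_eq hY, sub_mul, mul_sub, mul_sub, smul_mul_smul_comm]
  simp only [smul_mul_assoc, mul_smul_comm, one_mul, mul_one]
  abel

lemma trace_wedgeContract_mul_succ (a b c d : V) (p : ℕ) :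
    LinearMap.trace ℝ _ (wedgeContract a b (p + 1) * wedgeContract c d (p + 1)) =
      inner ℝ c b * inner ℝ a d * LinearMap.trace ℝ _ (1 : Module.End ℝ (PForm V p)) -
        inner ℝ c b * LinearMap.trace ℝ _ (wedgeContract a d p) -
        inner ℝ a d * LinearMap.trace ℝ _ (wedgeContract c b p) +
        LinearMap.trace ℝ _ (wedgeContract c b p * wedgeContract a d p) := by
  have h : (contractL b p ∘ₗ wedgeL c p) * (contractL d p ∘ₗ wedgeL a p) +
      (inner ℝ c b : ℝ) • wedgeContract a d p + (inner ℝ a d : ℝ) • wedgeContract c b p =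
      (inner ℝ c b * inner ℝ a d : ℝ) • (1 : Module.End ℝ (PForm V p)) +
        wedgeContract c b p * wedgeContract a d p :=
    mul_add_smul_add_smul (A := Module.End ℝ (PForm V p)) (contractL_comp_wedgeL_add b c p)
      (contractL_comp_wedgeL_add d a p)
  have h' := congrArg (LinearMap.trace ℝ _) h
  simp only [map_add, map_smul, smul_eq_mul] at h'
  have h2 : LinearMap.trace ℝ _ (wedgeContract a b (p + 1) * wedgeContract c d (p + 1)) =
      LinearMap.trace ℝ _ ((contractL b p ∘ₗ wedgeL c p) * (contractL d p ∘ₗ wedgeL a p)) :=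
    LinearMap.trace_comp_comm' (contractL b p ∘ₗ wedgeL c p ∘ₗ contractL d p) (wedgeL a p)
  rw [h2]
  linarith

/-- The recursion of `trace_wedgeContract_mul_succ` exchanges the two pairings at each step, so the
main coefficient in one degree is the secondary one in the next. The value of β is left open because
its pairing is annihilated by the curvature. -/
lemma trace_wedgeContract_mul (hV : 2 ≤ Module.finrank ℝ V) (p : ℕ) :
    ∃ β : ℝ, ∀ a b c d : V,
      LinearMap.trace ℝ _ (wedgeContract a b (p + 1) * wedgeContract c d (p + 1)) =
        inner ℝ a d * inner ℝ c b * ((Module.finrank ℝ V - 2).choose p : ℝ) +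
          inner ℝ a b * inner ℝ c d * β := by
  obtain ⟨m, hm⟩ := Nat.exists_eq_add_of_le' hV
  -- The induction needs β explicitly. The case p = 0 is separate because truncated subtraction
  -- would give C(m, 0) = 1 instead of 0.
  suffices h : ∀ a b c d : V,
      LinearMap.trace ℝ _ (wedgeContract a b (p + 1) * wedgeContract c d (p + 1)) =
        inner ℝ a d * inner ℝ c b * (m.choose p : ℝ) +
          inner ℝ a b * inner ℝ c d * (if p = 0 then 0 else (m.choose (p - 1) : ℝ)) from
    ⟨_, by simpa only [hm, Nat.add_sub_cancel] using h⟩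
  induction p with
  | zero =>
    intro a b c d
    rw [trace_wedgeContract_mul_succ, trace_one_pForm]
    simp [wedgeContract]
    ring
  | succ p ih =>
    intro a b c d
    rw [trace_wedgeContract_mul_succ, trace_one_pForm, ih, trace_wedgeContract (by omega),
      trace_wedgeContract (by omega), hm, if_neg p.succ_ne_zero, Nat.add_sub_cancel,
      show m + 2 - 1 = m + 1 by omega]
    rcases p with _ | p
    · simp
      ring
    · rw [if_neg p.succ_ne_zero, Nat.choose_succ_succ' (m + 1), Nat.choose_succ_succ' m (p + 1),
        Nat.choose_succ_succ' m p, Nat.add_sub_cancel]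
      push_cast
      rw [real_inner_comm]
      ring

lemma subsingleton_pForm {p : ℕ} (hp : Module.finrank ℝ V < p) : Subsingleton (PForm V p) := by
  refine Module.finrank_zero_iff (R := ℝ).1 ?_
  have h := trace_one_pForm (V := V) p
  rw [LinearMap.trace_one, Nat.choose_eq_zero_of_lt hp] at h
  exact_mod_cast h

instance finite_exteriorForms : Module.Finite ℝ (ExteriorForms V) := by
  let f : ExteriorForms V →ₗ[ℝ] ((p : Fin (Module.finrank ℝ V + 1)) → PForm V p) :=
    LinearMap.pi fun p ↦ LinearMap.proj (p : ℕ)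
  refine Module.Finite.of_injective f fun σ τ h ↦ funext fun p ↦ ?_
  by_cases hp : p < Module.finrank ℝ V + 1
  · exact congrFun h ⟨p, hp⟩
  · have := subsingleton_pForm (V := V) (p := p) (by omega)
    exact Subsingleton.elim _ _

/-- Forms of degree above the dimension vanish, so a degree-preserving operator is a finite sum of
blocks factoring through the projections; cyclicity gives the trace of each block. -/
lemma trace_exteriorForms (T : Module.End ℝ (ExteriorForms V))
    (R : (p : ℕ) → Module.End ℝ (PForm V p)) (hT : ∀ σ p, T σ p = R p (σ p)) :
    LinearMap.trace ℝ _ T =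
      ∑ p ∈ Finset.range (Module.finrank ℝ V + 1), LinearMap.trace ℝ _ (R p) := by
  have h : T = ∑ p ∈ Finset.range (Module.finrank ℝ V + 1),
      (T ∘ₗ LinearMap.single ℝ (PForm V) p) ∘ₗ LinearMap.proj p := by
    refine LinearMap.ext fun σ ↦ ?_
    have hσ : σ = ∑ p ∈ Finset.range (Module.finrank ℝ V + 1), Pi.single p (σ p) := by
      funext q
      rw [Finset.sum_apply]
      by_cases hq : q < Module.finrank ℝ V + 1
      · rw [Finset.sum_eq_single q, Pi.single_eq_same]
        · intro b _ hb
          exact Pi.single_eq_of_ne hb.symm _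
        · intro h
          simp at h
          omega
      · have := subsingleton_pForm (V := V) (p := q) (by omega)
        exact Subsingleton.elim _ _
    conv_lhs => rw [hσ]
    rw [map_sum, LinearMap.sum_apply]
    rfl
  have h2 := congrArg (LinearMap.trace ℝ _) h
  rw [map_sum] at h2
  rw [h2]
  refine Finset.sum_congr rfl fun p _ ↦ ?_
  rw [LinearMap.trace_comp_comm']
  congr 1
  ext1 φ
  change T (Pi.single p φ) p = _
  rw [hT, Pi.single_eq_same]

end Trace

/-! ### Curvature symmetries and the expansion of the Clifford sum. -/

section CurvatureAlgebra

/-- The algebraic symmetries of the components `⟨R(eᵢ, eⱼ) eₖ, eₗ⟩` of a Riemannian curvature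
tensor. -/
structure IsCurvatureArray {ι : Type*} (R : ι → ι → ι → ι → ℝ) : Prop where
  swap_left : ∀ i j k l, R i j k l = -R j i k l
  swap_right : ∀ i j k l, R i j k l = -R i j l k
  bianchi : ∀ i j k l, R i j k l + R j k i l + R k i j l = 0

/-- The classical octahedron argument: a combination of four Bianchi identities, with the
antisymmetries identifying the terms. -/
lemma IsCurvatureArray.pair_symm {ι : Type*} {R : ι → ι → ι → ι → ℝ} (hR : IsCurvatureArray R) (i j k l : ι) :
    R i j k l = R k l i j := by
  have h1 := hR.bianchi i j k l
  have h2 := hR.bianchi j k l i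
  have h3 := hR.bianchi k l i j
  have h4 := hR.bianchi l i j k
  have a1 := hR.swap_right j k i l
  have a2 := hR.swap_right k i j l
  have a3 := hR.swap_left l i k j
  have a4 := hR.swap_right i j l k
  have a5 := hR.swap_right j k l i
  have a6 := hR.swap_left k l j i
  have a7 := hR.swap_right k l j i
  have a8 := hR.swap_left l j k i
  have a9 := hR.swap_right l j k i
  have b1 := hR.swap_right l i k j
  have b2 := hR.swap_left i k l j
  have b3 := hR.swap_right i k l j
  have b4 := hR.swap_right k i l j
  have b5 := hR.swap_left j l i k
  have b6 := hR.swap_right j l i k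
  have b7 := hR.swap_right l j i k
  have b8 := hR.swap_left k i j l
  linarith

variable {ι A : Type*} [Fintype ι]

/-- Three times the sum is the sum of its cyclic rotations, in which each `P i j k` is multiplied by
the cyclic sum of the coefficients. -/
lemma sum_smul_eq_zero_of_cyclic [AddCommGroup A] [Module ℝ A] (c : ι → ι → ι → ℝ)
    (P : ι → ι → ι → A) (hc : ∀ i j k, c i j k + c j k i + c k i j = 0)
    (hP : ∀ i j k, P j k i = P i j k) : ∑ i, ∑ j, ∑ k, c i j k • P i j k = 0 := by
  have hrot (g : ι → ι → ι → A) : ∑ i, ∑ j, ∑ k, g i j k = ∑ i, ∑ j, ∑ k, g j k i := by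
    rw [Finset.sum_congr rfl fun i _ ↦ Finset.sum_comm, Finset.sum_comm]
  have h1 := hrot fun i j k ↦ c i j k • P i j k
  have h2 := hrot fun i j k ↦ c j k i • P j k i
  have h3 : ∑ i, ∑ j, ∑ k, c i j k • P i j k + ∑ i, ∑ j, ∑ k, c j k i • P j k i +
      ∑ i, ∑ j, ∑ k, c k i j • P k i j = 0 := by
    simp only [← Finset.sum_add_distrib]
    refine Finset.sum_eq_zero fun i _ ↦ Finset.sum_eq_zero fun j _ ↦ Finset.sum_eq_zero fun k _ ↦ ?_
    rw [hP i j k, ← hP k i j, ← add_smul, ← add_smul, hc, zero_smul]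
  rw [← h2, ← h1] at h3
  have h4 : (3 : ℝ) • ∑ i, ∑ j, ∑ k, c i j k • P i j k = 0 := by
    rw [← h3]
    module
  exact (smul_eq_zero.1 h4).resolve_left (by norm_num)

lemma sum_smul_eq_zero_of_symm_antisymm [AddCommGroup A] [Module ℝ A] (c : ι → ι → ℝ)
    (P : ι → ι → A) (hc : ∀ i j, c i j = c j i) (hP : ∀ i j, P i j + P j i = 0) :
    ∑ i, ∑ j, c i j • P i j = 0 := by
  have h : ∑ i, ∑ j, c i j • P i j + ∑ i, ∑ j, c i j • P i j = 0 := by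
    nth_rw 2 [Finset.sum_comm]
    simp only [← Finset.sum_add_distrib]
    refine Finset.sum_eq_zero fun i _ ↦ Finset.sum_eq_zero fun j _ ↦ ?_
    rw [hc j i, ← smul_add, hP, smul_zero]
  have h4 : (2 : ℝ) • ∑ i, ∑ j, c i j • P i j = 0 := by
    rw [← h]
    module
  exact (smul_eq_zero.1 h4).resolve_left (by norm_num)

variable [Ring A] [Algebra ℝ A]

/-- For fixed k, E_i E_j E_l is invariant under cyclic (hence even) permutations, so Bianchi in i,
j, l applies. -/
lemma sum_wedge_wedge_eq_zero {R : ι → ι → ι → ι → ℝ} (hR : IsCurvatureArray R) (E I : ι → A)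
    (hE : ∀ i j, E i * E j = -(E j * E i)) :
    ∑ i, ∑ j, ∑ k, ∑ l, R i j k l • (E i * E j * (E l * I k)) = 0 := by
  have h (k : ι) : ∑ i, ∑ j, ∑ l, R i j k l • (E i * E j * (E l * I k)) = 0 := by
    refine sum_smul_eq_zero_of_cyclic (fun i j l ↦ R i j k l)
      (fun i j l ↦ E i * E j * (E l * I k)) (fun i j l ↦ ?_) fun i j l ↦ ?_
    · rw [hR.swap_right i j k l, hR.swap_right j l k i, hR.swap_right l i k j]
      linarith [hR.bianchi i j l k]
    · rw [← mul_assoc, ← mul_assoc, mul_assoc (E j), hE l i, mul_neg, ← mul_assoc, hE j i]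
      simp
  calc _ = ∑ i, ∑ k, ∑ j, ∑ l, R i j k l • (E i * E j * (E l * I k)) :=
        Finset.sum_congr rfl fun i _ ↦ Finset.sum_comm
    _ = ∑ k, ∑ i, ∑ j, ∑ l, R i j k l • (E i * E j * (E l * I k)) := Finset.sum_comm
    _ = 0 := Finset.sum_eq_zero fun k _ ↦ h k

/-- Moving E_l to the left past both contractions leaves two Ricci-type sums, whose symmetric
coefficients meet the antisymmetric I I, and a term in I_i I_j I_k that Bianchi kills. -/
lemma sum_contract_contract_eq_zero [DecidableEq ι] {R : ι → ι → ι → ι → ℝ}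
    (hR : IsCurvatureArray R) (E I : ι → A) (hI : ∀ i j, I i * I j = -(I j * I i))
    (hIE : ∀ i j, I i * E j = (if i = j then (1 : ℝ) else 0) • (1 : A) - E j * I i) :
    ∑ i, ∑ j, ∑ k, ∑ l, R i j k l • (I i * I j * (E l * I k)) = 0 := by
  have hexp (i j k l : ι) : R i j k l • (I i * I j * (E l * I k)) =
      ((if j = l then R i j k l else 0) • (I i * I k) -
        (if i = l then R i j k l else 0) • (I j * I k)) +
        R i j k l • (E l * (I i * I j * I k)) := by
    have : I i * I j * (E l * I k) = (if j = l then (1 : ℝ) else 0) • (I i * I k) -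
        (if i = l then (1 : ℝ) else 0) • (I j * I k) + E l * (I i * I j * I k) := by
      calc I i * I j * (E l * I k) = I i * (I j * E l) * I k := by simp only [mul_assoc]
        _ = (if j = l then (1 : ℝ) else 0) • (I i * I k) - (I i * E l) * I j * I k := by
          rw [hIE j l, mul_sub, sub_mul]
          simp only [mul_assoc, mul_smul_comm, smul_mul_assoc, mul_one]
        _ = _ := by
          rw [hIE i l]
          simp only [sub_mul, mul_assoc, smul_mul_assoc, one_mul]
          abel
    rw [this]
    split_ifs <;> simp [smul_sub, smul_add]
  have h1 : ∑ i, ∑ j, ∑ k, ∑ l, (if j = l then R i j k l else 0) • (I i * I k) = 0 := by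
    have := sum_smul_eq_zero_of_symm_antisymm (fun i k ↦ ∑ j, R i j k j) (fun i k ↦ I i * I k)
      (fun i k ↦ Finset.sum_congr rfl fun j _ ↦ hR.pair_symm _ _ _ _)
      (fun i k ↦ by rw [hI i k]; simp)
    rw [← this]
    refine Finset.sum_congr rfl fun i _ ↦ ?_
    rw [Finset.sum_comm]
    refine Finset.sum_congr rfl fun k _ ↦ ?_
    rw [Finset.sum_smul]
    refine Finset.sum_congr rfl fun j _ ↦ ?_
    simp [ite_smul]
  have h2 : ∑ i, ∑ j, ∑ k, ∑ l, (if i = l then R i j k l else 0) • (I j * I k) = 0 := by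
    have := sum_smul_eq_zero_of_symm_antisymm (fun j k ↦ ∑ i, R i j k i) (fun j k ↦ I j * I k)
      (fun j k ↦ Finset.sum_congr rfl fun i _ ↦ by
        rw [hR.pair_symm i j k i, hR.swap_left k i, hR.swap_right i k i j, neg_neg])
      (fun i k ↦ by rw [hI i k]; simp)
    rw [← this, Finset.sum_comm]
    refine Finset.sum_congr rfl fun j _ ↦ ?_
    rw [Finset.sum_comm]
    refine Finset.sum_congr rfl fun k _ ↦ ?_
    rw [Finset.sum_smul]
    refine Finset.sum_congr rfl fun i _ ↦ ?_
    simp [ite_smul]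
  have h3 : ∑ i, ∑ j, ∑ k, ∑ l, R i j k l • (E l * (I i * I j * I k)) = 0 := by
    have h (l : ι) : ∑ i, ∑ j, ∑ k, R i j k l • (E l * (I i * I j * I k)) = 0 := by
      refine sum_smul_eq_zero_of_cyclic (fun i j k ↦ R i j k l)
        (fun i j k ↦ E l * (I i * I j * I k)) (fun i j k ↦ hR.bianchi i j k l) fun i j k ↦ ?_
      rw [mul_assoc (I j), hI k i, mul_neg, ← mul_assoc (I j), hI j i]
      simp
    calc _ = ∑ i, ∑ j, ∑ l, ∑ k, R i j k l • (E l * (I i * I j * I k)) :=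
          Finset.sum_congr rfl fun i _ ↦ Finset.sum_congr rfl fun j _ ↦ Finset.sum_comm
      _ = ∑ i, ∑ l, ∑ j, ∑ k, R i j k l • (E l * (I i * I j * I k)) :=
          Finset.sum_congr rfl fun i _ ↦ Finset.sum_comm
      _ = ∑ l, ∑ i, ∑ j, ∑ k, R i j k l • (E l * (I i * I j * I k)) := Finset.sum_comm
      _ = 0 := Finset.sum_eq_zero fun k _ ↦ h k
  simp only [hexp, Finset.sum_add_distrib, Finset.sum_sub_distrib]
  rw [h1, h2, h3, sub_zero, add_zero]

lemma sum_Ioi_add_sum_Ioi [LinearOrder ι] [LocallyFiniteOrderTop ι] {B : Type*} [AddCommGroup B]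
    (f : ι → ι → B) (hf : ∀ i j, f i j = f j i) (hf0 : ∀ i, f i i = 0) :
    ∑ i, ∑ j ∈ Finset.Ioi i, f i j + ∑ i, ∑ j ∈ Finset.Ioi i, f i j = ∑ i, ∑ j, f i j := by
  have h1 : ∑ i, ∑ j ∈ Finset.Ioi i, f i j = ∑ i, ∑ j, if i < j then f i j else 0 := by
    refine Finset.sum_congr rfl fun i _ ↦ ?_
    rw [← Finset.sum_filter]
    exact Finset.sum_congr (by ext; simp) fun _ _ ↦ rfl
  rw [h1]
  nth_rw 2 [Finset.sum_comm]
  simp only [← Finset.sum_add_distrib]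
  refine Finset.sum_congr rfl fun i _ ↦ Finset.sum_congr rfl fun j _ ↦ ?_
  rcases lt_trichotomy i j with h | rfl | h
  · simp [h, h.not_gt]
  · simp [hf0]
  · simp [h, h.not_gt, hf i j]

lemma sum_clifford_curvature [LinearOrder ι] [LocallyFiniteOrderTop ι] {R : ι → ι → ι → ι → ℝ}
    (hR : IsCurvatureArray R) (C E I : ι → A) (X : ι → ι → A) (hC : ∀ i, C i + I i = E i)
    (hE : ∀ i j, E i * E j + E j * E i = 0) (hI : ∀ i j, I i * I j + I j * I i = 0)
    (hIE : ∀ i j, I i * E j + E j * I i = (if i = j then (1 : ℝ) else 0) • (1 : A))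
    (hX : ∀ i j, X i j = ∑ k, ∑ l, R i j k l • (E l * I k)) :
    ∑ i, ∑ j ∈ Finset.Ioi i, C i * C j * X i j =
      ∑ i, ∑ j, ∑ k, ∑ l, (-R i j k l) • (E i * I j * (E l * I k)) := by
  have hE' (i j) : E i * E j = -(E j * E i) := eq_neg_of_add_eq_zero_left (hE i j)
  have hI' (i j) : I i * I j = -(I j * I i) := eq_neg_of_add_eq_zero_left (hI i j)
  have hIE' (i j) : I i * E j = (if i = j then (1 : ℝ) else 0) • (1 : A) - E j * I i :=
    eq_sub_of_add_eq (hIE i j)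
  have hC' (i) : C i = E i - I i := eq_sub_of_add_eq (hC i)
  have hXs (i j) : X i j = -X j i := by
    simp only [hX, ← Finset.sum_neg_distrib, ← neg_smul]
    exact Finset.sum_congr rfl fun k _ ↦ Finset.sum_congr rfl fun l _ ↦ by
      rw [hR.swap_left i j]
  have hX0 (i) : X i i = 0 := by
    rw [hX]
    refine Finset.sum_eq_zero fun k _ ↦ Finset.sum_eq_zero fun l _ ↦ ?_
    have := hR.swap_left i i k l
    rw [show R i i k l = 0 by linarith, zero_smul]
  have hCC (i j) (h : i ≠ j) : C i * C j = -(C j * C i) := by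
    have h1 := hIE' i j
    have h2 := hIE' j i
    rw [if_neg h, zero_smul, zero_sub] at h1
    rw [if_neg h.symm, zero_smul, zero_sub] at h2
    rw [hC', hC', sub_mul, mul_sub, mul_sub, sub_mul, mul_sub, mul_sub, h1, h2, hE' i j, hI' i j]
    abel
  -- Off the diagonal both C_i C_j and X_ij are antisymmetric, so the ordered sum is half of the
  -- full one.
  have hsymm (i j) : C i * C j * X i j = C j * C i * X j i := by
    rcases eq_or_ne i j with rfl | h
    · rfl
    · rw [hCC i j h, hXs i j, neg_mul_neg]
  have hsum := sum_Ioi_add_sum_Ioi (fun i j ↦ C i * C j * X i j) hsymm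
    fun i ↦ by rw [hX0, mul_zero]
  have hEEX : ∑ i, ∑ j, E i * E j * X i j = 0 := by
    rw [← sum_wedge_wedge_eq_zero hR E I hE']
    simp only [hX, Finset.mul_sum, mul_smul_comm]
  have hIIX : ∑ i, ∑ j, I i * I j * X i j = 0 := by
    rw [← sum_contract_contract_eq_zero hR E I hI' hIE']
    simp only [hX, Finset.mul_sum, mul_smul_comm]
  have hIEX : ∑ i, ∑ j, I i * E j * X i j = ∑ i, ∑ j, E i * I j * X i j := by
    rw [Finset.sum_comm]
    refine Finset.sum_congr rfl fun i _ ↦ Finset.sum_congr rfl fun j _ ↦ ?_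
    rcases eq_or_ne j i with rfl | h
    · rw [hX0, mul_zero, mul_zero]
    · rw [hIE', if_neg h, zero_smul, zero_sub, hXs j i, neg_mul_neg]
  have hCCX : ∑ i, ∑ j, C i * C j * X i j =
      -(∑ i, ∑ j, E i * I j * X i j + ∑ i, ∑ j, E i * I j * X i j) := by
    calc _ = ∑ i, ∑ j, (E i * E j * X i j + I i * I j * X i j -
          (E i * I j * X i j + I i * E j * X i j)) := by
          refine Finset.sum_congr rfl fun i _ ↦ Finset.sum_congr rfl fun j _ ↦ ?_
          rw [hC', hC']
          noncomm_ring
      _ = _ := by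
          simp only [Finset.sum_sub_distrib, Finset.sum_add_distrib]
          rw [hEEX, hIIX, hIEX]
          abel
  have hfin : ∑ i, ∑ j, ∑ k, ∑ l, (-R i j k l) • (E i * I j * (E l * I k)) =
      -∑ i, ∑ j, E i * I j * X i j := by
    simp only [hX, Finset.mul_sum, mul_smul_comm, neg_smul, Finset.sum_neg_distrib]
  rw [hfin]
  rw [hCCX, ← two_smul ℝ, ← two_smul ℝ, ← smul_neg] at hsum
  exact smul_right_injective A (two_ne_zero (α := ℝ)) hsum

end CurvatureAlgebra

/-! ### From a curvature tensor to the trace of the Weitzenböck operator. -/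

section CurvatureTensor

variable {V : Type*} [NormedAddCommGroup V] [InnerProductSpace ℝ V]

/-- The trace of a bilinear form is independent of the orthonormal basis; applied in each pair of
slots, this gives the invariance of the scalar curvature. -/
lemma sum_inner_inner_eq {ι ι' : Type*} [Fintype ι] [Fintype ι'] (e : OrthonormalBasis ι ℝ V)
    (e' : OrthonormalBasis ι' ℝ V) (B : V →ₗ[ℝ] V →ₗ[ℝ] ℝ) :
    ∑ i, B (e i) (e i) = ∑ i, B (e' i) (e' i) := by
  have h (i : ι) : B (e i) (e i) = ∑ k, ∑ l, inner ℝ (e' l) (e i) * inner ℝ (e i) (e' k) *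
      B (e' l) (e' k) := by
    conv_lhs => rw [← e'.sum_repr' (e i), map_sum]
    refine Finset.sum_congr rfl fun k _ ↦ ?_
    rw [map_sum, LinearMap.sum_apply]
    refine Finset.sum_congr rfl fun l _ ↦ ?_
    rw [map_smul, map_smul, LinearMap.smul_apply, smul_eq_mul, smul_eq_mul,
      real_inner_comm (e i) (e' k)]
    ring
  simp only [h]
  rw [Finset.sum_comm]
  refine Finset.sum_congr rfl fun k _ ↦ ?_
  rw [Finset.sum_comm]
  simp only [← Finset.sum_mul, e.sum_inner_mul_inner]
  classical
  simp [orthonormal_iff_ite.1 e'.orthonormal]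

/-- The algebraic symmetries of a Riemannian curvature tensor on a Euclidean vector space. -/
structure IsCurvatureTensor (T : V →ₗ[ℝ] V →ₗ[ℝ] V →ₗ[ℝ] V) : Prop where
  swap : ∀ u v w, T u v w = -T v u w
  skew : ∀ u v w z, inner ℝ (T u v w) z = -inner ℝ w (T u v z)
  bianchi : ∀ u v w, T u v w + T v w u + T w u v = 0

variable {T : V →ₗ[ℝ] V →ₗ[ℝ] V →ₗ[ℝ] V}

lemma IsCurvatureTensor.apply_self (hT : IsCurvatureTensor T) (u w : V) : T u u w = 0 := by
  have h : (2 : ℝ) • T u u w = 0 := by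
    rw [two_smul]
    exact eq_neg_iff_add_eq_zero.1 (hT.swap u u w)
  exact (smul_eq_zero.1 h).resolve_left two_ne_zero

lemma IsCurvatureTensor.isCurvatureArray (hT : IsCurvatureTensor T) {ι : Type*} (e : ι → V) :
    IsCurvatureArray fun i j k l ↦ inner ℝ (T (e i) (e j) (e k)) (e l) where
  swap_left i j k l := by rw [hT.swap, inner_neg_left]
  swap_right i j k l := by rw [hT.skew, real_inner_comm]
  bianchi i j k l := by rw [← inner_add_left, ← inner_add_left, hT.bianchi, inner_zero_left]

/-- The scalar curvature does not depend on the orthonormal basis. -/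
lemma sum_sum_inner_eq {ι ι' : Type*} [Fintype ι] [Fintype ι'] (e : OrthonormalBasis ι ℝ V)
    (e' : OrthonormalBasis ι' ℝ V) (T : V →ₗ[ℝ] V →ₗ[ℝ] V →ₗ[ℝ] V) :
    ∑ i, ∑ j, inner ℝ (T (e i) (e j) (e j)) (e i) =
      ∑ i, ∑ j, inner ℝ (T (e' i) (e' j) (e' j)) (e' i) := by
  have h1 (i : ι) : ∑ j, inner ℝ (T (e i) (e j) (e j)) (e i) =
      ∑ j, inner ℝ (T (e i) (e' j) (e' j)) (e i) := by
    have := sum_inner_inner_eq e e' ((T (e i)).compr₂ (innerₗ V (e i)))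
    simpa [real_inner_comm] using this
  have h2 (j : ι') : ∑ i, inner ℝ (T (e i) (e' j) (e' j)) (e i) =
      ∑ i, inner ℝ (T (e' i) (e' j) (e' j)) (e' i) := by
    have := sum_inner_inner_eq e e' (innerₗ V ∘ₗ (T.flip (e' j)).flip (e' j))
    simpa [real_inner_comm] using this
  simp only [h1]
  rw [Finset.sum_comm]
  simp only [h2]
  rw [Finset.sum_comm]

/-- `F` is the action of `R(u, v)` on `p`-forms induced by the curvature tensor `T`. -/
def IsInducedFormCurvature (T : V →ₗ[ℝ] V →ₗ[ℝ] V →ₗ[ℝ] V)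
    (F : V → V → (p : ℕ) → Module.End ℝ (PForm V p)) : Prop :=
  ∀ u v p φ w, F u v p φ w = -∑ k, φ (Function.update w k (T u v (w k)))

variable {F : V → V → (p : ℕ) → Module.End ℝ (PForm V p)}

/-- The action on forms is the derivation extending -R(u,v), and skewness makes R(u,v) the adjoint
of -R(u,v), so no sign survives. -/
lemma IsInducedFormCurvature.eq_sum_wedgeContract (hF : IsInducedFormCurvature T F)
    (hT : IsCurvatureTensor T) {ι : Type*} [Fintype ι] (e : OrthonormalBasis ι ℝ V) (u v : V)
    (p : ℕ) : F u v p = ∑ k, wedgeContract (T u v (e k)) (e k) p := by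
  ext φ w
  rw [hF, sum_wedgeContract_apply e (-T u v) (T u v)]
  · simp only [LinearMap.neg_apply, ← Finset.sum_neg_distrib]
    exact Finset.sum_congr rfl fun k _ ↦ (φ.toMultilinearMap.map_update_neg w k _).symm
  · intro v w
    rw [hT.skew]
    simp

lemma IsInducedFormCurvature.pi_eq_sum (hF : IsInducedFormCurvature T F)
    (hT : IsCurvatureTensor T) {ι : Type*} [Fintype ι] (e : OrthonormalBasis ι ℝ V) (u v : V) :
    (LinearMap.pi fun p ↦ F u v p ∘ₗ LinearMap.proj p : Module.End ℝ (ExteriorForms V)) =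
      ∑ k, ∑ l, (inner ℝ (T u v (e k)) (e l) : ℝ) • (wedge (e l) * contract (e k)) := by
  have h1 : (LinearMap.pi fun p ↦ F u v p ∘ₗ LinearMap.proj p : Module.End ℝ (ExteriorForms V)) =
      ∑ k, wedge (T u v (e k)) * contract (e k) := by
    refine LinearMap.ext fun σ ↦ funext fun p ↦ ?_
    rw [LinearMap.sum_apply, Finset.sum_apply]
    simp only [wedge_mul_contract_apply]
    rw [LinearMap.pi_apply, LinearMap.comp_apply, LinearMap.proj_apply,
      hF.eq_sum_wedgeContract hT e, LinearMap.sum_apply]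
  rw [h1]
  refine Finset.sum_congr rfl fun k _ ↦ ?_
  have h2 : wedge (T u v (e k)) = ∑ l, inner ℝ (T u v (e k)) (e l) • wedge (e l) := by
    conv_lhs => rw [← e.sum_repr' (T u v (e k)), wedge_sum]
    exact Finset.sum_congr rfl fun l _ ↦ by rw [real_inner_comm]
  rw [h2, Finset.sum_mul]
  exact Finset.sum_congr rfl fun l _ ↦ smul_mul_assoc _ _ _

lemma cliffordAction_ι_mul_ι (u v : V) :
    cliffordAction V (CliffordAlgebra.ι _ u * CliffordAlgebra.ι _ v) =
      cliffordMul u * cliffordMul v := by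
  rw [map_mul]
  congr 1
  · exact CliffordAlgebra.lift_ι_apply _ _ _
  · exact CliffordAlgebra.lift_ι_apply _ _ _

/-- The Weitzenböck operator on `p`-forms. -/
noncomputable def weitzenbockForm {ι : Type*} [Fintype ι] (T : V →ₗ[ℝ] V →ₗ[ℝ] V →ₗ[ℝ] V)
    (e : ι → V) (p : ℕ) : Module.End ℝ (PForm V p) :=
  ∑ i, ∑ j, ∑ k, ∑ l, (-inner ℝ (T (e i) (e j) (e k)) (e l) : ℝ) •
    (wedgeContract (e i) (e j) p * wedgeContract (e l) (e k) p)

lemma sum_cliffordAction_apply {ι : Type*} [Fintype ι] [LinearOrder ι] [LocallyFiniteOrderTop ι]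
    (hT : IsCurvatureTensor T) (hF : IsInducedFormCurvature T F) (e : OrthonormalBasis ι ℝ V)
    (σ : ExteriorForms V) (p : ℕ) :
    (∑ i, ∑ j ∈ Finset.Ioi i,
      cliffordAction V (CliffordAlgebra.ι _ (e i) * CliffordAlgebra.ι _ (e j)) *
        (LinearMap.pi fun p ↦ F (e i) (e j) p ∘ₗ LinearMap.proj p :
          Module.End ℝ (ExteriorForms V))) σ p = weitzenbockForm T e p (σ p) := by
  have h := sum_clifford_curvature (A := Module.End ℝ (ExteriorForms V))
    (hT.isCurvatureArray e) (fun i ↦ cliffordMul (e i)) (fun i ↦ wedge (e i))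
    (fun i ↦ contract (e i)) (fun i j ↦ LinearMap.pi fun p ↦ F (e i) (e j) p ∘ₗ LinearMap.proj p)
    (fun i ↦ cliffordMul_add_contract (e i)) (fun i j ↦ wedge_mul_wedge_add (e i) (e j))
    (fun i j ↦ contract_mul_contract_add (e i) (e j))
    (fun i j ↦ by
      have := contract_mul_wedge_add (e i) (e j)
      rw [orthonormal_iff_ite.1 e.orthonormal] at this
      simpa only [eq_comm] using this)
    (fun i j ↦ hF.pi_eq_sum hT e (e i) (e j))
  simp only [cliffordAction_ι_mul_ι]
  have h' := congrArg (fun S : Module.End ℝ (ExteriorForms V) ↦ S σ p) h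
  refine h'.trans ?_
  simp only [weitzenbockForm, LinearMap.sum_apply, Finset.sum_apply, LinearMap.smul_apply,
    Pi.smul_apply]
  refine Finset.sum_congr rfl fun i _ ↦ Finset.sum_congr rfl fun j _ ↦
    Finset.sum_congr rfl fun k _ ↦ Finset.sum_congr rfl fun l _ ↦ ?_
  congr 1
  change (wedge (e i) * contract (e j)) ((wedge (e l) * contract (e k)) σ) p = _
  rw [wedge_mul_contract_apply, wedge_mul_contract_apply]
  rfl

lemma trace_weitzenbockForm_succ {n : ℕ} (hn : 2 ≤ n) (hT : IsCurvatureTensor T)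
    (e : OrthonormalBasis (Fin n) ℝ V) (p : ℕ) :
    LinearMap.trace ℝ _ (weitzenbockForm T e (p + 1)) =
      ((n - 2).choose p : ℝ) * ∑ i, ∑ j, inner ℝ (T (e i) (e j) (e j)) (e i) := by
  have : FiniteDimensional ℝ V := e.toBasis.finiteDimensional_of_finite
  have hV : Module.finrank ℝ V = n := by
    rw [Module.finrank_eq_card_basis e.toBasis, Fintype.card_fin]
  obtain ⟨β, h⟩ := trace_wedgeContract_mul (V := V) (by omega) p
  simp only [weitzenbockForm, map_sum, map_smul, h, hV, smul_eq_mul,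
    orthonormal_iff_ite.1 e.orthonormal, Finset.mul_sum]
  refine Finset.sum_congr rfl fun i _ ↦ Finset.sum_congr rfl fun j _ ↦ ?_
  -- The diagonal vanishes, which removes β; for i ≠ j only k = i, l = j contributes, with -R_ijij =
  -- R_ijji.
  rcases eq_or_ne i j with rfl | hij
  · simp [hT.apply_self]
  · have hA := (hT.isCurvatureArray e).swap_right i j
    simp [hij, Finset.sum_ite_eq]
    rw [hA i j]
    ring

lemma trace_weitzenbockForm_zero {ι : Type*} [Fintype ι] (e : ι → V) :
    LinearMap.trace ℝ _ (weitzenbockForm T e 0) = 0 := by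
  simp [weitzenbockForm, wedgeContract]

end CurvatureTensor

/-! ### Closure properties of smooth vector fields. -/

section Smooth

lemma minSmoothness_le_infty (k : ℕ∞) : minSmoothness ℝ k ≤ ∞ := by
  rw [minSmoothness_of_isRCLikeNormedField]
  exact_mod_cast le_top

lemma isManifold_minSmoothness {n : ℕ} (M : Type*) [TopologicalSpace M]
    [ChartedSpace (EuclideanSpace ℝ (Fin n)) M] [IsManifold (𝓡 n) ∞ M] (k : ℕ∞) :
    IsManifold (𝓡 n) (minSmoothness ℝ k) M :=
  IsManifold.of_le (n := ∞) (minSmoothness_le_infty k)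

variable {n : ℕ} {M : Type*} [TopologicalSpace M] [ChartedSpace (EuclideanSpace ℝ (Fin n)) M]
  [IsManifold (𝓡 n) ∞ M]

lemma VField.IsSmooth.mdifferentiableAt {X : VField n M} (hX : X.IsSmooth) (x : M) :
    MDifferentiableAt (𝓡 n) (𝓡 n).tangent (fun x ↦ (⟨x, X x⟩ : TangentBundle (𝓡 n) M)) x :=
  (ContMDiff.mdifferentiable hX (by simp)) x

lemma VField.IsSmooth.add {X Y : VField n M} (hX : X.IsSmooth) (hY : Y.IsSmooth) :
    VField.IsSmooth (X + Y) := ContMDiff.add_section hX hY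

lemma VField.IsSmooth.smul {f : M → ℝ} {X : VField n M} (hf : ContMDiff (𝓡 n) 𝓘(ℝ) ∞ f)
    (hX : X.IsSmooth) : VField.IsSmooth (f • X) := ContMDiff.smul_section hf hX

lemma VField.IsSmooth.sum_smul {ι : Type*} [Fintype ι] {X : ι → VField n M} (c : ι → ℝ)
    (hX : ∀ i, (X i).IsSmooth) : VField.IsSmooth (fun y ↦ ∑ i, c i • X i y) :=
  ContMDiff.sum_section fun i _ ↦ ContMDiff.const_smul_section (hX i)

lemma VField.IsSmooth.mlieBracket {X Y : VField n M} (hX : X.IsSmooth) (hY : Y.IsSmooth) :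
    VField.IsSmooth (VectorField.mlieBracket (𝓡 n) X Y) := fun x ↦
  have : IsManifold (𝓡 n) (minSmoothness ℝ 2) M := isManifold_minSmoothness M 2
  have : IsManifold (𝓡 n) (((⊤ : ℕ∞) : WithTop ℕ∞) + 1) M := by simpa using ‹IsManifold (𝓡 n) ∞ M›
  ContMDiffAt.mlieBracket_vectorField (m := ⊤) (n := ⊤) (hX x) (hY x) (by simp)

lemma VField.IsSmooth.cov {cov : Connection n M} (hcov : cov.ContMDiffCovariantDerivative ∞)
    {X Y : VField n M} (hX : X.IsSmooth) (hY : Y.IsSmooth) :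
    VField.IsSmooth (fun y ↦ cov Y y (X y)) := by
  have h := hcov.contMDiff.contMDiff (σ := Y) (by simpa using! ContMDiff.contMDiffOn hY)
  exact (contMDiffOn_univ.1 h).clm_bundle_apply hX

/-- The derivative `X f` of a function along a vector field. -/
noncomputable def VField.deriv (X : VField n M) (f : M → ℝ) : M → ℝ :=
  fun x ↦ mvfderiv (𝓡 n) f x (X x)

lemma contMDiff_deriv {X : VField n M} {f : M → ℝ} (hX : X.IsSmooth)
    (hf : ContMDiff (𝓡 n) 𝓘(ℝ) ∞ f) : ContMDiff (𝓡 n) 𝓘(ℝ) ∞ (X.deriv f) := by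
  exact (contMDiff_snd_tangentBundle_modelSpace ℝ 𝓘(ℝ)).comp
    ((hf.contMDiff_tangentMap (m := ∞) (by simp)).comp hX)

end Smooth

/-! ### Cut-off frames. -/

section Frame

variable {n : ℕ} {M : Type*} [TopologicalSpace M]
  [ChartedSpace (EuclideanSpace ℝ (Fin n)) M] [IsManifold (𝓡 n) ∞ M]

/-- Globally smooth vector fields `s i` and one-forms `θ i` which are, up to cutting off, dual
frames near `x`. -/
structure CutoffFrame (x : M) where
  s : Fin n → VField n M
  θ : Fin n → (y : M) → TangentSpace (𝓡 n) y →ₗ[ℝ] ℝ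
  ψ : M → ℝ
  smooth_s : ∀ i, (s i).IsSmooth
  smooth_θ : ∀ i (W : VField n M), W.IsSmooth → ContMDiff (𝓡 n) 𝓘(ℝ) ∞ fun y ↦ θ i y (W y)
  smooth_ψ : ContMDiff (𝓡 n) 𝓘(ℝ) ∞ ψ
  ψ_self : ψ x = 1
  sum_eq : ∀ (y : M) (w : TangentSpace (𝓡 n) y), ψ y • w = ∑ i, θ i y w • s i y

lemma CutoffFrame.sum_self {x : M} (F : CutoffFrame (n := n) x) (w : TangentSpace (𝓡 n) x) :
    w = ∑ i, F.θ i x w • F.s i x := by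
  rw [← F.sum_eq, F.ψ_self, one_smul]

/-- Both a local frame and its coframe are multiplied by a bump function f supported in the
trivialization, whence ψ = f². -/
lemma nonempty_cutoffFrame [T2Space M] (x : M) : Nonempty (CutoffFrame (n := n) x) := by
  let f : SmoothBumpFunction (𝓡 n) x := Classical.arbitrary _
  let t := trivializationAt (EuclideanSpace ℝ (Fin n)) (TangentSpace (𝓡 n) : M → Type _) x
  let b := (EuclideanSpace.basisFun (Fin n) ℝ).toBasis
  have hf : tsupport f ⊆ t.baseSet := f.tsupport_subset_chartAt_source
  have hft : ContMDiff (𝓡 n) 𝓘(ℝ) ∞ f := f.contMDiff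
  refine ⟨⟨fun i ↦ (f : M → ℝ) • t.localFrame b i, fun i y ↦ f y • t.localFrameCoeff (𝓡 n) b i y,
    fun y ↦ f y * f y, fun i ↦ ?_, fun i W hW ↦ ?_, hft.mul hft, ?_, fun y w ↦ ?_⟩⟩
  · exact ContMDiffOn.smul_section_of_tsupport hft.contMDiffOn t.open_baseSet hf
      (t.contMDiffOn_localFrame_baseSet ∞ b i)
  · refine f.contMDiff_smul ?_
    exact contMDiffOn_baseSet_localFrameCoeff b (ContMDiff.contMDiffOn hW) i
  · simp
  · by_cases hy : y ∈ t.baseSet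
    · classical
      -- Frame coefficients are pointwise, so any section through w serves, even a discontinuous
      -- one.
      have h := t.eq_sum_localFrameCoeff_smul (I := 𝓡 n) (b := b) 
        (s := Function.update 0 y w) hy
      simp only [Function.update_self] at h
      conv_lhs => rw [h, Finset.smul_sum]
      refine Finset.sum_congr rfl fun i _ ↦ ?_
      simp [smul_smul]
      ring_nf
    · have : f y = 0 := image_eq_zero_of_notMem_tsupport fun h ↦ hy (hf h)
      simp [this]

end Frame
-- Tensoriality, and the Lie bracket as a commutator.
section Tensoriality

variable {n : ℕ} {M : Type*} [TopologicalSpace M]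
  [ChartedSpace (EuclideanSpace ℝ (Fin n)) M] [IsManifold (𝓡 n) ∞ M]

/-- A map on smooth vector fields which is linear over smooth functions is given by a pointwise
formula. -/
lemma CutoffFrame.tensorial_eq {x : M} (F : CutoffFrame (n := n) x) {A : Type*} [AddCommGroup A]
    [Module ℝ A] (Φ : VField n M → A)
    (hadd : ∀ X Y : VField n M, X.IsSmooth → Y.IsSmooth → Φ (X + Y) = Φ X + Φ Y)
    (hsmul : ∀ (f : M → ℝ) (X : VField n M), ContMDiff (𝓡 n) 𝓘(ℝ) ∞ f → X.IsSmooth →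
      Φ (f • X) = f x • Φ X) (Z : VField n M) (hZ : Z.IsSmooth) :
    Φ Z = ∑ i, F.θ i x (Z x) • Φ (F.s i) := by
  have hZ0 : (0 : VField n M) = (fun _ : M ↦ (0 : ℝ)) • Z := by
    ext1 y
    exact (zero_smul ℝ (Z y)).symm
  have h0 : Φ 0 = 0 := by rw [hZ0, hsmul _ Z contMDiff_const hZ, zero_smul]
  have hs0 : VField.IsSmooth (0 : VField n M) := by
    rw [hZ0]
    exact hZ.smul contMDiff_const
  have hsum (S : Finset (Fin n)) : VField.IsSmooth (∑ i ∈ S, (fun y ↦ F.θ i y (Z y)) • F.s i) ∧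
      Φ (∑ i ∈ S, (fun y ↦ F.θ i y (Z y)) • F.s i) = ∑ i ∈ S, F.θ i x (Z x) • Φ (F.s i) := by
    classical
    induction S using Finset.induction_on with
    | empty => simpa using! ⟨hs0, h0⟩
    | insert a S ha ih =>
      have h1 := VField.IsSmooth.smul (F.smooth_θ a Z hZ) (F.smooth_s a)
      rw [Finset.sum_insert ha, Finset.sum_insert ha]
      exact ⟨h1.add ih.1, by rw [hadd _ _ h1 ih.1, ih.2, hsmul _ _ (F.smooth_θ a Z hZ) (F.smooth_s a)]⟩
  rw [← (hsum Finset.univ).2]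
  -- Since ψ(x) = 1, multiplying by ψ does not change the value, and ψ Z is globally a combination
  -- of the frame fields.
  calc Φ Z = Φ (F.ψ • Z) := by rw [hsmul _ _ F.smooth_ψ hZ, F.ψ_self, one_smul]
    _ = _ := by
      congr 1
      ext1 y
      rw [Finset.sum_apply]
      exact F.sum_eq y (Z y)

/-- Every tangent vector extends to a smooth vector field. -/
lemma exists_isSmooth_eq [T2Space M] {x : M} (v : TangentSpace (𝓡 n) x) :
    ∃ X : VField n M, X.IsSmooth ∧ X x = v := by
  obtain ⟨F⟩ := nonempty_cutoffFrame (n := n) x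
  exact ⟨fun y ↦ ∑ i, F.θ i x v • F.s i y, VField.IsSmooth.sum_smul _ F.smooth_s,
    (F.sum_self v).symm⟩

open VectorField in
/-- The Lie bracket of smooth vector fields is the commutator of derivations. -/
lemma deriv_mlieBracket [T2Space M] {X Y : VField n M} (hX : X.IsSmooth) (hY : Y.IsSmooth) {f : M → ℝ}
    (hf : ContMDiff (𝓡 n) 𝓘(ℝ) ∞ f) (x : M) :
    VField.deriv (mlieBracket (𝓡 n) X Y) f x = X.deriv (Y.deriv f) x - Y.deriv (X.deriv f) x := by
  have : IsManifold (𝓡 n) (minSmoothness ℝ 3) M := isManifold_minSmoothness M 3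
  have : IsManifold (𝓡 n) (minSmoothness ℝ 2) M := isManifold_minSmoothness M 2
  have hmd {g : M → ℝ} (hg : ContMDiff (𝓡 n) 𝓘(ℝ) ∞ g) (y : M) :
      MDifferentiableAt (𝓡 n) 𝓘(ℝ) g y := (hg.mdifferentiable (by simp)) y
  have hbr (U Z : VField n M) (g : M → ℝ) (hg : ContMDiff (𝓡 n) 𝓘(ℝ) ∞ g) (hZ : Z.IsSmooth) :
      mlieBracket (𝓡 n) U (g • Z) = U.deriv g • Z + g • mlieBracket (𝓡 n) U Z := by
    ext1 y
    exact mlieBracket_smul_right (hmd hg y) (hZ.mdifferentiableAt y)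
  have hbr2 (U V Z : VField n M) (hU : U.IsSmooth) (hV : V.IsSmooth) (hZ : Z.IsSmooth) :
      mlieBracket (𝓡 n) U (mlieBracket (𝓡 n) V (f • Z)) =
        U.deriv (V.deriv f) • Z + V.deriv f • mlieBracket (𝓡 n) U Z +
        (U.deriv f • mlieBracket (𝓡 n) V Z + f • mlieBracket (𝓡 n) U (mlieBracket (𝓡 n) V Z)) := by
    have h1 := contMDiff_deriv hV hf
    rw [hbr V Z f hf hZ, ← hbr U _ f hf (hV.mlieBracket hZ), ← hbr U _ _ h1 hZ]
    ext1 y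
    exact mlieBracket_add_right ((hZ.smul h1).mdifferentiableAt y)
      (((hV.mlieBracket hZ).smul hf).mdifferentiableAt y)
  have hle : minSmoothness ℝ 2 ≤ ∞ := minSmoothness_le_infty 2
  have hjac (Z : VField n M) (hZ : Z.IsSmooth) := leibniz_identity_mlieBracket (I := 𝓡 n)
    (ContMDiff.of_le hX hle) (ContMDiff.of_le hY hle) (ContMDiff.of_le hZ hle)
  -- The Jacobi identity for X, Y, f Z is expanded by the product rule and compared with f times the
  -- one for Z; only the defect of the commutator formula, times Z, is left.
  have key (Z : VField n M) (hZ : Z.IsSmooth) :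
      (X.deriv (Y.deriv f) x - Y.deriv (X.deriv f) x -
        VField.deriv (mlieBracket (𝓡 n) X Y) f x) • Z x = 0 := by
    have h1 := congrFun (hjac (f • Z) (hZ.smul hf)) x
    have h2 := congrFun (hjac Z hZ) x
    rw [hbr2 X Y Z hX hY hZ] at h1
    rw [Pi.add_apply (mlieBracket (𝓡 n) (mlieBracket (𝓡 n) X Y) (f • Z)), hbr2 Y X Z hY hX hZ,
      hbr _ Z f hf hZ] at h1
    simp only [Pi.add_apply, Pi.smul_apply'] at h1 h2
    rw [h2] at h1
    rw [← sub_eq_zero] at h1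
    rw [← h1]
    module
  by_contra hne
  -- A nonzero defect would force the tangent space to be trivial, and then both sides vanish
  -- anyway.
  have hz (w : TangentSpace (𝓡 n) x) : w = 0 := by
    obtain ⟨Z, hZ, rfl⟩ := exists_isSmooth_eq w
    exact (smul_eq_zero.1 (key Z hZ)).resolve_left (sub_ne_zero.2 (Ne.symm hne))
  apply hne
  simp only [VField.deriv, hz (X x), hz (Y x), hz (mlieBracket (𝓡 n) X Y x), map_zero, sub_zero]

end Tensoriality

/-! ### The curvature of the tangent bundle as a tensor, and the first Bianchi identity. -/

section Curvature

open VectorField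

variable {n : ℕ} {M : Type*} [TopologicalSpace M]
  [ChartedSpace (EuclideanSpace ℝ (Fin n)) M] [IsManifold (𝓡 n) ∞ M] {cov : Connection n M}

lemma cov_add {X Y : VField n M} (hX : X.IsSmooth) (hY : Y.IsSmooth) (x : M) :
    cov (X + Y) x = cov X x + cov Y x :=
  cov.isCovariantDerivativeOnUniv.add (hX.mdifferentiableAt x) (hY.mdifferentiableAt x)

lemma cov_smul_apply {f : M → ℝ} {X : VField n M} (hf : ContMDiff (𝓡 n) 𝓘(ℝ) ∞ f)
    (hX : X.IsSmooth) (U : VField n M) (x : M) :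
    cov (f • X) x (U x) = f x • cov X x (U x) + U.deriv f x • X x := by
  rw [cov.isCovariantDerivativeOnUniv.leibniz (hX.mdifferentiableAt x)
    ((hf.mdifferentiable (by simp)) x)]
  rfl

lemma curvVF_swap (X Y Z : VField n M) (x : M) : curvVF cov X Y Z x = -curvVF cov Y X Z x := by
  simp only [curvVF]
  rw [mlieBracket_swap_apply, map_neg]
  abel

variable (hcov : cov.ContMDiffCovariantDerivative ∞)
include hcov

lemma curvVF_add_right {X Y Z Z' : VField n M} (hX : X.IsSmooth) (hY : Y.IsSmooth)
    (hZ : Z.IsSmooth) (hZ' : Z'.IsSmooth) (x : M) :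
    curvVF cov X Y (Z + Z') x = curvVF cov X Y Z x + curvVF cov X Y Z' x := by
  have h (U : VField n M) (hU : U.IsSmooth) : cov (fun y ↦ cov (Z + Z') y (U y)) x =
      cov (fun y ↦ cov Z y (U y)) x + cov (fun y ↦ cov Z' y (U y)) x := by
    rw [← cov_add (hU.cov hcov hZ) (hU.cov hcov hZ')]
    congr 1
    ext1 y
    rw [cov_add hZ hZ']
    rfl
  simp only [curvVF, h X hX, h Y hY, cov_add hZ hZ' x, add_apply]
  abel

/-- Terms with first derivatives of f along X or Y are symmetric in X and Y and cancel; the second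
derivatives cancel against the bracket term by `deriv_mlieBracket`. -/
lemma curvVF_smul_right [T2Space M] {X Y Z : VField n M} {f : M → ℝ} (hX : X.IsSmooth)
    (hY : Y.IsSmooth) (hZ : Z.IsSmooth) (hf : ContMDiff (𝓡 n) 𝓘(ℝ) ∞ f) (x : M) :
    curvVF cov X Y (f • Z) x = f x • curvVF cov X Y Z x := by
  have h (U V : VField n M) (hU : U.IsSmooth) (hV : V.IsSmooth) :
      cov (fun y ↦ cov (f • Z) y (U y)) x (V x) =
        f x • cov (fun y ↦ cov Z y (U y)) x (V x) + V.deriv f x • cov Z x (U x) +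
        (U.deriv f x • cov Z x (V x) + V.deriv (U.deriv f) x • Z x) := by
    have h1 : (fun y ↦ cov (f • Z) y (U y)) = f • (fun y ↦ cov Z y (U y)) + U.deriv f • Z := by
      ext1 y
      exact cov_smul_apply hf hZ U y
    have h2 := contMDiff_deriv hU hf
    rw [h1, cov_add ((hU.cov hcov hZ).smul hf) (hZ.smul h2), add_apply,
      cov_smul_apply hf (hU.cov hcov hZ), cov_smul_apply h2 hZ]
  simp only [curvVF]
  rw [h X Y hX hY, h Y X hY hX, cov_smul_apply hf hZ (mlieBracket (𝓡 n) X Y),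
    deriv_mlieBracket hX hY hf]
  module

lemma curvVF_add_left {X X' Y Z : VField n M} (hX : X.IsSmooth) (hX' : X'.IsSmooth)
    (hZ : Z.IsSmooth) (x : M) :
    curvVF cov (X + X') Y Z x = curvVF cov X Y Z x + curvVF cov X' Y Z x := by
  have : IsManifold (𝓡 n) (minSmoothness ℝ 2) M := isManifold_minSmoothness M 2
  have h : cov (fun y ↦ cov Z y ((X + X') y)) x =
      cov (fun y ↦ cov Z y (X y)) x + cov (fun y ↦ cov Z y (X' y)) x := by
    rw [← cov_add (hX.cov hcov hZ) (hX'.cov hcov hZ)]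
    congr 1
    ext1 y
    exact map_add _ _ _
  simp only [curvVF, h]
  rw [mlieBracket_add_left (hX.mdifferentiableAt x) (hX'.mdifferentiableAt x)]
  simp only [Pi.add_apply, map_add, add_apply]
  abel

lemma curvVF_smul_left {X Y Z : VField n M} {f : M → ℝ} (hX : X.IsSmooth)
    (hZ : Z.IsSmooth) (hf : ContMDiff (𝓡 n) 𝓘(ℝ) ∞ f) (x : M) :
    curvVF cov (f • X) Y Z x = f x • curvVF cov X Y Z x := by
  have : IsManifold (𝓡 n) (minSmoothness ℝ 2) M := isManifold_minSmoothness M 2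
  have h : (fun y ↦ cov Z y ((f • X) y)) = f • fun y ↦ cov Z y (X y) := by
    ext1 y
    exact (cov Z y).map_smul (f y) (X y)
  simp only [curvVF]
  rw [h, cov_smul_apply hf (hX.cov hcov hZ), Pi.smul_apply', map_smul,
    mlieBracket_smul_left ((hf.mdifferentiable (by simp)) x) (hX.mdifferentiableAt x), map_add,
    map_smul, map_smul]
  simp only [VField.deriv]
  module

/-- The curvature of a smooth connection is a tensor. -/
lemma exists_curvVF_eq [T2Space M] (x : M) :
    ∃ T : TangentSpace (𝓡 n) x →ₗ[ℝ] TangentSpace (𝓡 n) x →ₗ[ℝ] TangentSpace (𝓡 n) x →ₗ[ℝ]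
      TangentSpace (𝓡 n) x, ∀ X Y Z : VField n M, X.IsSmooth → Y.IsSmooth → Z.IsSmooth →
        curvVF cov X Y Z x = T (X x) (Y x) (Z x) := by
  obtain ⟨F⟩ := nonempty_cutoffFrame (n := n) x
  refine ⟨∑ i, (F.θ i x).smulRight (∑ j, (F.θ j x).smulRight (∑ k, (F.θ k x).smulRight
    (curvVF cov (F.s i) (F.s j) (F.s k) x))), fun X Y Z hX hY hZ ↦ ?_⟩
  simp only [LinearMap.sum_apply, LinearMap.smulRight_apply, LinearMap.smul_apply]
  rw [F.tensorial_eq (fun X ↦ curvVF cov X Y Z x) (fun X X' hX hX' ↦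
    curvVF_add_left hcov hX hX' hZ x) (fun f X hf hX ↦ curvVF_smul_left hcov hX hZ hf x) X hX]
  refine Finset.sum_congr rfl fun i _ ↦ ?_
  congr 1
  have hi := F.smooth_s i
  rw [F.tensorial_eq (fun Y ↦ curvVF cov (F.s i) Y Z x) (fun Y Y' hY hY' ↦ by
      simp only [curvVF_swap (F.s i)]
      rw [curvVF_add_left hcov hY hY' hZ x, neg_add]) (fun f Y hf hY ↦ by
      simp only [curvVF_swap (F.s i)]
      rw [curvVF_smul_left hcov hY hZ hf x, smul_neg]) Y hY]
  refine Finset.sum_congr rfl fun j _ ↦ ?_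
  congr 1
  exact F.tensorial_eq (fun Z ↦ curvVF cov (F.s i) (F.s j) Z x) (fun Z Z' hZ hZ' ↦
    curvVF_add_right hcov hi (F.smooth_s j) hZ hZ' x) (fun f Z hf hZ ↦
    curvVF_smul_right hcov hi (F.smooth_s j) hZ hf x) Z hZ

/-- Vanishing torsion, used twice, turns the cyclic sum into the Jacobi identity for iterated
brackets. -/
lemma curvVF_bianchi (htor : cov.torsion = 0) {X Y Z : VField n M} (hX : X.IsSmooth)
    (hY : Y.IsSmooth) (hZ : Z.IsSmooth) (x : M) :
    curvVF cov X Y Z x + curvVF cov Y Z X x + curvVF cov Z X Y x = 0 := by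
  have : IsManifold (𝓡 n) (minSmoothness ℝ 3) M := isManifold_minSmoothness M 3
  have ht {U V : VField n M} (hU : U.IsSmooth) (hV : V.IsSmooth) (y : M) :
      cov V y (U y) - cov U y (V y) = mlieBracket (𝓡 n) U V y :=
    cov.torsion_eq_zero_iff.1 htor (hU.mdifferentiableAt y) (hV.mdifferentiableAt y)
  have h {U V W : VField n M} (hU : U.IsSmooth) (hV : V.IsSmooth) (hW : W.IsSmooth) :
      cov (fun y ↦ cov W y (V y)) x (U x) - cov (fun y ↦ cov V y (W y)) x (U x) -
        cov U x (mlieBracket (𝓡 n) V W x) =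
        mlieBracket (𝓡 n) U (mlieBracket (𝓡 n) V W) x := by
    rw [← ht hU (hV.mlieBracket hW)]
    have h1 : (fun y ↦ cov W y (V y)) = mlieBracket (𝓡 n) V W + fun y ↦ cov V y (W y) := by
      ext1 y
      exact sub_eq_iff_eq_add.1 (ht hV hW y)
    rw [h1, cov_add (hV.mlieBracket hW) (hW.cov hcov hV), add_apply]
    abel
  have hle : minSmoothness ℝ 2 ≤ ∞ := minSmoothness_le_infty 2
  have hjac := leibniz_identity_mlieBracket_apply (I := 𝓡 n) (x := x)
    (ContMDiff.of_le hX hle x) (ContMDiff.of_le hY hle x) (ContMDiff.of_le hZ hle x)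
  have h1 := h hX hY hZ
  have h2 := h hY hZ hX
  have h3 := h hZ hX hY
  have h4 : mlieBracket (𝓡 n) X (mlieBracket (𝓡 n) Y Z) x +
      mlieBracket (𝓡 n) Y (mlieBracket (𝓡 n) Z X) x +
      mlieBracket (𝓡 n) Z (mlieBracket (𝓡 n) X Y) x = 0 := by
    rw [hjac, mlieBracket_swap_apply (V := Z), mlieBracket_swap (V := Z) (W := X)]
    have : mlieBracket (𝓡 n) Y (-mlieBracket (𝓡 n) X Z) x =
        -mlieBracket (𝓡 n) Y (mlieBracket (𝓡 n) X Z) x := by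
      have := mlieBracket_const_smul_right (I := 𝓡 n) (V := Y) (c := (-1 : ℝ))
        ((hX.mlieBracket hZ).mdifferentiableAt x)
      rwa [neg_one_smul, neg_one_smul] at this
    rw [this]
    abel
  rw [← h1, ← h2, ← h3] at h4
  rw [← h4]
  simp only [curvVF]
  abel

end Curvature

/-! ### The curvature of the induced connection on forms. -/

section FormCurvature

open VectorField

variable {n : ℕ} {M : Type*} [TopologicalSpace M]
  [ChartedSpace (EuclideanSpace ℝ (Fin n)) M]

lemma deriv_add (X : VField n M) {f g : M → ℝ} (hf : ContMDiff (𝓡 n) 𝓘(ℝ) ∞ f)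
    (hg : ContMDiff (𝓡 n) 𝓘(ℝ) ∞ g) : X.deriv (f + g) = X.deriv f + X.deriv g := by
  ext1 x
  simp only [VField.deriv, Pi.add_apply]
  rw [mvfderiv_add ((hf.mdifferentiable (by simp)) x) ((hg.mdifferentiable (by simp)) x)]
  rfl

lemma deriv_sub (X : VField n M) {f g : M → ℝ} (hf : ContMDiff (𝓡 n) 𝓘(ℝ) ∞ f)
    (hg : ContMDiff (𝓡 n) 𝓘(ℝ) ∞ g) : X.deriv (f - g) = X.deriv f - X.deriv g := by
  ext1 x
  simp only [VField.deriv, Pi.sub_apply]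
  rw [mvfderiv_sub ((hf.mdifferentiable (by simp)) x) ((hg.mdifferentiable (by simp)) x)]
  rfl

lemma contMDiff_sum_and_deriv_sum {ι : Type*} (X : VField n M) (S : Finset ι) {f : ι → M → ℝ}
    (hf : ∀ i, ContMDiff (𝓡 n) 𝓘(ℝ) ∞ (f i)) :
    ContMDiff (𝓡 n) 𝓘(ℝ) ∞ (∑ i ∈ S, f i) ∧ X.deriv (∑ i ∈ S, f i) = ∑ i ∈ S, X.deriv (f i) := by
  classical
  induction S using Finset.induction_on with
  | empty =>
    refine ⟨contMDiff_const (c := (0 : ℝ)), funext fun x ↦ ?_⟩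
    simp only [VField.deriv, Finset.sum_empty, mvfderiv_zero]
    rfl
  | insert a S ha ih =>
    rw [Finset.sum_insert ha, Finset.sum_insert ha]
    exact ⟨(hf a).add ih.1, by rw [deriv_add X (hf a) ih.1, ih.2]⟩

lemma covForm_eq [IsManifold (𝓡 n) ∞ M] {cov : Connection n M} {p : ℕ}
    (X : VField n M) (Ω : (Fin p → VField n M) → M → ℝ)
    (W : Fin p → VField n M) : covForm cov X Ω W =
      X.deriv (Ω W) - ∑ i, Ω (Function.update W i fun y ↦ cov (W i) y (X y)) := by
  ext1 x
  rw [Pi.sub_apply, Finset.sum_apply]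
  rfl

lemma isSmooth_update [IsManifold (𝓡 n) ∞ M] {p : ℕ} {W : Fin p → VField n M} (hW : ∀ i, (W i).IsSmooth) (i : Fin p)
    {Z : VField n M} (hZ : Z.IsSmooth) (j : Fin p) : VField.IsSmooth (Function.update W i Z j) := by
  rcases eq_or_ne j i with rfl | h
  · rwa [Function.update_self]
  · rw [Function.update_of_ne h]
    exact hW j

lemma DForm.eval_update {p : ℕ} (η : DForm n M p) (W : Fin p → VField n M) (i : Fin p)
    (Z : VField n M) (x : M) :
    η.eval (Function.update W i Z) x = η x (Function.update (fun k ↦ W k x) i (Z x)) := by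
  simp only [DForm.eval]
  congr 1
  ext1 k
  rcases eq_or_ne k i with rfl | h
  · simp
  · simp [h]

/-- The curvature of the induced connection on `p`-forms is minus the derivation extending the
curvature of the tangent bundle. -/
lemma curvForm_eq [T2Space M] [IsManifold (𝓡 n) ∞ M] {cov : Connection n M}
    (hcov : cov.ContMDiffCovariantDerivative ∞) {p : ℕ}
    {X Y : VField n M} (hX : X.IsSmooth) (hY : Y.IsSmooth) {η : DForm n M p} (hη : η.IsSmooth)
    {W : Fin p → VField n M} (hW : ∀ i, (W i).IsSmooth) (x : M) :
    curvForm cov X Y η.eval W x =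
      -∑ i, η x (Function.update (fun k ↦ W k x) i (curvVF cov X Y (W i) x)) := by
  let N (U Z : VField n M) : VField n M := fun y ↦ cov Z y (U y)
  have hN {U Z : VField n M} (hU : U.IsSmooth) (hZ : Z.IsSmooth) : (N U Z).IsSmooth :=
    hU.cov hcov hZ
  -- The second derivative acts on the already updated tuple, so the diagonal entry i = j is the
  -- iterated derivative ∇_V ∇_U of W_i.
  let D (U V : VField n M) (i j : Fin p) : ℝ :=
    η.eval (Function.update (Function.update W i (N U (W i))) j
      (N V (Function.update W i (N U (W i)) j))) x
  have h1 {U V : VField n M} (hU : U.IsSmooth) (hV : V.IsSmooth) :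
      covForm cov U (covForm cov V η.eval) W x =
        U.deriv (V.deriv (η.eval W)) x -
          ∑ i, U.deriv (η.eval (Function.update W i (N V (W i)))) x -
          ∑ i, V.deriv (η.eval (Function.update W i (N U (W i)))) x + ∑ i, ∑ j, D U V i j := by
    have hs (i : Fin p) : ContMDiff (𝓡 n) 𝓘(ℝ) ∞ (η.eval (Function.update W i (N V (W i)))) :=
      hη _ (isSmooth_update hW i (hN hV (hW i)))
    have h2 := contMDiff_sum_and_deriv_sum U Finset.univ hs
    rw [covForm_eq, covForm_eq, deriv_sub U (contMDiff_deriv hV (hη W hW)) h2.1, h2.2]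
    simp only [covForm_eq, Pi.sub_apply, Finset.sum_apply, Finset.sum_sub_distrib]
    change _ = _ - _ - ∑ i, V.deriv (η.eval (Function.update W i (N U (W i)))) x +
      ∑ i, ∑ j, D U V i j
    ring
  -- Derivatives in two different slots commute and cancel after exchanging i and j; only the
  -- diagonal survives.
  have hD : ∑ i, ∑ j, D X Y i j - ∑ i, ∑ j, D Y X i j =
      ∑ i, (η.eval (Function.update W i (N Y (N X (W i)))) x -
        η.eval (Function.update W i (N X (N Y (W i)))) x) := by
    nth_rw 2 [Finset.sum_comm]
    simp only [← Finset.sum_sub_distrib]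
    refine Finset.sum_congr rfl fun i _ ↦ ?_
    rw [Finset.sum_eq_single i]
    · simp [D]
    · intro j _ hj
      simp only [D, Function.update_of_ne hj, Function.update_of_ne hj.symm]
      rw [Function.update_comm hj, sub_self]
    · simp
  have hval (Z : VField n M) (i : Fin p) := DForm.eval_update η W i Z x
  have hC (i : Fin p) : η x (Function.update (fun k ↦ W k x) i (curvVF cov X Y (W i) x)) =
      η.eval (Function.update W i (N X (N Y (W i)))) x -
      η.eval (Function.update W i (N Y (N X (W i)))) x -
      η.eval (Function.update W i (N (mlieBracket (𝓡 n) X Y) (W i))) x := by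
    rw [hval, hval, hval, ← AlternatingMap.map_update_sub, ← AlternatingMap.map_update_sub]
    rfl
  rw [curvForm, h1 hX hY, h1 hY hX, covForm_eq]
  simp only [hC, Finset.sum_sub_distrib, Pi.sub_apply, Finset.sum_apply] at hD ⊢
  rw [deriv_mlieBracket hX hY (hη W hW)]
  change _ - (_ - ∑ i, η.eval (Function.update W i (N (mlieBracket (𝓡 n) X Y) (W i))) x) = _
  linarith

/-- Every `p`-form at a point extends to a smooth differential form. -/
lemma exists_dForm_isSmooth_eq [T2Space M] [IsManifold (𝓡 n) ∞ M] {x : M} {p : ℕ}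
    (φ : PForm (TangentSpace (𝓡 n) x) p) : ∃ η : DForm n M p, η.IsSmooth ∧ η x = φ := by
  obtain ⟨F⟩ := nonempty_cutoffFrame (n := n) x
  -- The form φ is pulled back along a smooth family of maps T_yM → T_xM which is the identity at y
  -- = x.
  refine ⟨fun y ↦ φ.compLinearMap (∑ i, (F.θ i y).smulRight (F.s i x)), fun W hW ↦ ?_, ?_⟩
  · have h : DForm.eval (fun y ↦ φ.compLinearMap (∑ i, (F.θ i y).smulRight (F.s i x))) W =
        fun y ↦ ∑ r : Fin p → Fin n, (∏ k, F.θ (r k) y (W k y)) * φ fun k ↦ F.s (r k) x := by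
      ext1 y
      simp only [DForm.eval, AlternatingMap.compLinearMap_apply, LinearMap.sum_apply,
        LinearMap.smulRight_apply]
      refine (φ.toMultilinearMap.map_sum fun k i ↦ F.θ i y (W k y) • F.s i x).trans ?_
      exact Finset.sum_congr rfl fun r _ ↦ φ.toMultilinearMap.map_smul_univ _ _
    rw [h]
    exact contMDiff_finsetSum fun r _ ↦ (contMDiff_finsetProd fun k _ ↦
      F.smooth_θ (r k) (W k) (hW k)).mul contMDiff_const
  · ext w
    rw [AlternatingMap.compLinearMap_apply]
    congr 1
    ext1 k
    rw [LinearMap.sum_apply]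
    exact (F.sum_self (w k)).symm

end FormCurvature

/-! ### Symmetries of the Levi-Civita curvature. -/

section Riemannian

open VectorField

variable {n : ℕ} {M : Type*} [TopologicalSpace M] [T2Space M]
  [ChartedSpace (EuclideanSpace ℝ (Fin n)) M] [IsManifold (𝓡 n) ∞ M]
  [Bundle.RiemannianBundle (fun x : M ↦ TangentSpace (𝓡 n) x)]
  [IsContMDiffRiemannianBundle (𝓡 n) ∞ (EuclideanSpace ℝ (Fin n))
    (fun x : M ↦ TangentSpace (𝓡 n) x)]
  {cov : Connection n M}

/-- The commutator formula applied to the function ⟨Z, W⟩: by metric compatibility the mixed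
products of first derivatives cancel, leaving the two curvature terms. -/
lemma inner_curvVF (hcov : cov.ContMDiffCovariantDerivative ∞) (hmet : cov.IsMetricCompatible)
    {X Y Z W : VField n M} (hX : X.IsSmooth) (hY : Y.IsSmooth) (hZ : Z.IsSmooth) (hW : W.IsSmooth)
    (x : M) :
    inner ℝ (curvVF cov X Y Z x) (W x) = -inner ℝ (Z x) (curvVF cov X Y W x) := by
  let N (U Z : VField n M) : VField n M := fun y ↦ cov Z y (U y)
  have hN {U Z : VField n M} (hU : U.IsSmooth) (hZ : Z.IsSmooth) : (N U Z).IsSmooth :=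
    hU.cov hcov hZ
  let g (Z W : VField n M) : M → ℝ := fun y ↦ inner ℝ (Z y) (W y)
  have hg {Z W : VField n M} (hZ : Z.IsSmooth) (hW : W.IsSmooth) :
      ContMDiff (𝓡 n) 𝓘(ℝ) ∞ (g Z W) := ContMDiff.inner_bundle hZ hW
  have hd (U : VField n M) {Z W : VField n M} (hZ : Z.IsSmooth) (hW : W.IsSmooth) :
      U.deriv (g Z W) = g (N U Z) W + g Z (N U W) :=
    funext fun y ↦ hmet.mvfderiv_inner_eq U (hZ.mdifferentiableAt y) (hW.mdifferentiableAt y)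
  have hdd {U V : VField n M} (hV : V.IsSmooth) :
      U.deriv (V.deriv (g Z W)) x = g (N U (N V Z)) W x + g (N V Z) (N U W) x +
        (g (N U Z) (N V W) x + g Z (N U (N V W)) x) := by
    rw [hd V hZ hW, deriv_add U (hg (hN hV hZ) hW) (hg hZ (hN hV hW)), hd U (hN hV hZ) hW,
      hd U hZ (hN hV hW)]
    rfl
  have h1 := deriv_mlieBracket hX hY (hg hZ hW) x
  rw [hdd hX, hdd hY, hd _ hZ hW, Pi.add_apply] at h1
  have h2 : inner ℝ (curvVF cov X Y Z x) (W x) = g (N X (N Y Z)) W x - g (N Y (N X Z)) W x -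
      g (N (mlieBracket (𝓡 n) X Y) Z) W x := by
    simp only [curvVF, inner_sub_left, g, N]
  have h3 : inner ℝ (Z x) (curvVF cov X Y W x) = g Z (N X (N Y W)) x - g Z (N Y (N X W)) x -
      g Z (N (mlieBracket (𝓡 n) X Y) W) x := by
    simp only [curvVF, inner_sub_right, g, N]
  rw [h2, h3]
  linarith

lemma IsLeviCivita.isCurvatureTensor (hcov : IsLeviCivita cov) {x : M}
    {T : TangentSpace (𝓡 n) x →ₗ[ℝ] TangentSpace (𝓡 n) x →ₗ[ℝ] TangentSpace (𝓡 n) x →ₗ[ℝ]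
      TangentSpace (𝓡 n) x} (hT : ∀ X Y Z : VField n M, X.IsSmooth → Y.IsSmooth → Z.IsSmooth →
        curvVF cov X Y Z x = T (X x) (Y x) (Z x)) : IsCurvatureTensor T where
  swap u v w := by
    obtain ⟨X, hX, rfl⟩ := exists_isSmooth_eq u
    obtain ⟨Y, hY, rfl⟩ := exists_isSmooth_eq v
    obtain ⟨Z, hZ, rfl⟩ := exists_isSmooth_eq w
    rw [← hT X Y Z hX hY hZ, ← hT Y X Z hY hX hZ, curvVF_swap]
  skew u v w z := by
    obtain ⟨X, hX, rfl⟩ := exists_isSmooth_eq u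
    obtain ⟨Y, hY, rfl⟩ := exists_isSmooth_eq v
    obtain ⟨Z, hZ, rfl⟩ := exists_isSmooth_eq w
    obtain ⟨W, hW, rfl⟩ := exists_isSmooth_eq z
    rw [← hT X Y Z hX hY hZ, ← hT X Y W hX hY hW,
      inner_curvVF hcov.smooth hcov.metric hX hY hZ hW]
  bianchi u v w := by
    obtain ⟨X, hX, rfl⟩ := exists_isSmooth_eq u
    obtain ⟨Y, hY, rfl⟩ := exists_isSmooth_eq v
    obtain ⟨Z, hZ, rfl⟩ := exists_isSmooth_eq w
    rw [← hT X Y Z hX hY hZ, ← hT Y Z X hY hZ hX, ← hT Z X Y hZ hX hY,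
      curvVF_bianchi hcov.smooth hcov.torsion hX hY hZ]

end Riemannian

/-! ### Uniqueness of the curvature endomorphisms. -/

section Uniqueness

variable {n : ℕ} {M : Type*} [TopologicalSpace M] [T2Space M]
  [ChartedSpace (EuclideanSpace ℝ (Fin n)) M] [IsManifold (𝓡 n) ∞ M] {cov : Connection n M} {x : M}

lemma IsCurvature.unique {u v : TangentSpace (𝓡 n) x}
    {L L' : TangentSpace (𝓡 n) x →ₗ[ℝ] TangentSpace (𝓡 n) x} (hL : IsCurvature cov u v L)
    (hL' : IsCurvature cov u v L') : L = L' := by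
  obtain ⟨X, hX, rfl⟩ := exists_isSmooth_eq u
  obtain ⟨Y, hY, rfl⟩ := exists_isSmooth_eq v
  refine LinearMap.ext fun w ↦ ?_
  obtain ⟨Z, hZ, rfl⟩ := exists_isSmooth_eq w
  rw [hL X Y Z hX hY hZ rfl rfl, hL' X Y Z hX hY hZ rfl rfl]

lemma IsFormCurvature.unique {p : ℕ} {u v : TangentSpace (𝓡 n) x}
    {L L' : PForm (TangentSpace (𝓡 n) x) p →ₗ[ℝ] PForm (TangentSpace (𝓡 n) x) p}
    (hL : IsFormCurvature cov p u v L) (hL' : IsFormCurvature cov p u v L') : L = L' := by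
  obtain ⟨X, hX, rfl⟩ := exists_isSmooth_eq u
  obtain ⟨Y, hY, rfl⟩ := exists_isSmooth_eq v
  refine LinearMap.ext fun φ ↦ ?_
  obtain ⟨η, hη, rfl⟩ := exists_dForm_isSmooth_eq φ
  ext w
  choose W hW hWw using fun i ↦ exists_isSmooth_eq (w i)
  obtain rfl : (fun i ↦ W i x) = w := funext hWw
  rw [hL X Y η W hX hY hη hW rfl rfl, hL' X Y η W hX hY hη hW rfl rfl]

end Uniqueness

/-! ### Derivations from endomorphisms, and the binomial sum. -/

section Weitzenbock

variable {V : Type*} [NormedAddCommGroup V] [InnerProductSpace ℝ V]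

/-- Every endomorphism of `V` extends to minus a derivation on `p`-forms. -/
lemma exists_formDerivation {ι : Type*} [Fintype ι] (e : OrthonormalBasis ι ℝ V) (A : V →ₗ[ℝ] V)
    (p : ℕ) : ∃ D : Module.End ℝ (PForm V p), ∀ (φ : PForm V p) (w : Fin p → V),
      D φ w = -∑ k, φ (Function.update w k (A (w k))) := by
  have : FiniteDimensional ℝ V := e.toBasis.finiteDimensional_of_finite
  refine ⟨-∑ i, wedgeContract (A.adjoint (e i)) (e i) p, fun φ w ↦ ?_⟩
  rw [← sum_wedgeContract_apply e A A.adjoint (fun v w ↦ LinearMap.adjoint_inner_left A w v) p φ w]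
  rfl

/-- The index is the form degree minus one; the top term p = n - 1 is zero, so the sum is a full row
of Pascal's triangle. -/
lemma sum_choose_sub_one {n : ℕ} (hn : 2 ≤ n) (s : ℝ) :
    ∑ p ∈ Finset.range n, ((n - 2).choose p : ℝ) * s = (2 : ℝ) ^ ((n : ℤ) - 2) * s := by
  obtain ⟨m, rfl⟩ := Nat.exists_eq_add_of_le' hn
  rw [Nat.add_sub_cancel, ← Finset.sum_mul, Finset.sum_range_succ,
    Nat.choose_eq_zero_of_lt (Nat.lt_succ_self m)]
  have h := Nat.sum_range_choose m
  have h' : ∑ p ∈ Finset.range (m + 1), (m.choose p : ℝ) = 2 ^ m := by exact_mod_cast h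
  rw [h']
  simp

end Weitzenbock

end WeitzenbockTrace

/-! ### The trace formulas. -/

open WeitzenbockTrace in
theorem mainTheorem8 {n : ℕ} {M : Type*} [TopologicalSpace M] [T2Space M]
    [ChartedSpace (EuclideanSpace ℝ (Fin n)) M] [IsManifold (𝓡 n) ∞ M]
    [Bundle.RiemannianBundle (fun x : M ↦ TangentSpace (𝓡 n) x)]
    [IsContMDiffRiemannianBundle (𝓡 n) ∞ (EuclideanSpace ℝ (Fin n))
      (fun x : M ↦ TangentSpace (𝓡 n) x)]
    (cov : WeitzenbockTrace.Connection n M) (hcov : WeitzenbockTrace.IsLeviCivita cov)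
    (x : M) (e e' : OrthonormalBasis (Fin n) ℝ (TangentSpace (𝓡 n) x)) :
    (∀ u v : TangentSpace (𝓡 n) x,
      (∃! L, WeitzenbockTrace.IsCurvature cov u v L) ∧
        ∀ p : ℕ, ∃! L, WeitzenbockTrace.IsFormCurvature cov p u v L) ∧
    (∀ p : ℕ, 1 ≤ p → p < n →
      ∃ Rp : Module.End ℝ (WeitzenbockTrace.PForm (TangentSpace (𝓡 n) x) p),
        (∀ φ, WeitzenbockTrace.weitzenbock cov e (Pi.single p φ) = Pi.single p (Rp φ)) ∧
          LinearMap.trace ℝ _ Rp =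
            ((n - 2).choose (p - 1) : ℝ) * WeitzenbockTrace.scalarCurvature cov e') ∧
    LinearMap.trace ℝ _ (WeitzenbockTrace.weitzenbock cov e) =
      (2 : ℝ) ^ ((n : ℤ) - 2) * WeitzenbockTrace.scalarCurvature cov e' := by
  obtain ⟨T, hT⟩ := exists_curvVF_eq hcov.smooth x
  have hTens : IsCurvatureTensor T := hcov.isCurvatureTensor hT
  choose F hF using fun (u v : TangentSpace (𝓡 n) x) (p : ℕ) ↦ exists_formDerivation e (T u v) p
  have hcurv (u v : TangentSpace (𝓡 n) x) : IsCurvature cov u v (T u v) := by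
    rintro X Y Z hX hY hZ rfl rfl
    exact (hT X Y Z hX hY hZ).symm
  have hform (u v : TangentSpace (𝓡 n) x) (p : ℕ) : IsFormCurvature cov p u v (F u v p) := by
    rintro X Y η W hX hY hη hW rfl rfl
    rw [hF, curvForm_eq hcov.smooth hX hY hη hW]
    congr 1
    exact Finset.sum_congr rfl fun i _ ↦ by rw [hT X Y (W i) hX hY (hW i)]
  -- Existence and uniqueness identify the endomorphism picked by `Classical.epsilon`.
  have hcurv_eq (u v : TangentSpace (𝓡 n) x) : curvature cov u v = T u v :=
    (Classical.epsilon_spec ⟨_, hcurv u v⟩ : IsCurvature cov u v (curvature cov u v)).unique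
      (hcurv u v)
  have hform_eq (u v : TangentSpace (𝓡 n) x) (p : ℕ) : formCurvature cov p u v = F u v p :=
    (Classical.epsilon_spec ⟨_, hform u v p⟩ :
      IsFormCurvature cov p u v (formCurvature cov p u v)).unique (hform u v p)
  have hs : scalarCurvature cov e' = ∑ i, ∑ j, inner ℝ (T (e i) (e j) (e j)) (e i) := by
    simp only [scalarCurvature, hcurv_eq]
    exact sum_sum_inner_eq e' e T
  have hW (σ : ExteriorForms (TangentSpace (𝓡 n) x)) (p : ℕ) :
      weitzenbock cov e σ p = weitzenbockForm T e p (σ p) := by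
    rw [← sum_cliffordAction_apply hTens hF e σ p]
    simp only [weitzenbock, exteriorCurvature, hform_eq]
  refine ⟨fun u v ↦ ⟨⟨T u v, hcurv u v, fun L hL ↦ hL.unique (hcurv u v)⟩, fun p ↦
    ⟨F u v p, hform u v p, fun L hL ↦ hL.unique (hform u v p)⟩⟩, fun p hp hpn ↦
    ⟨weitzenbockForm T e p, fun φ ↦ ?_, ?_⟩, ?_⟩
  · funext q
    rw [hW]
    rcases eq_or_ne q p with rfl | hq
    · rw [Pi.single_eq_same, Pi.single_eq_same]
    · rw [Pi.single_eq_of_ne hq, Pi.single_eq_of_ne hq, map_zero]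
  · obtain ⟨q, rfl⟩ := Nat.exists_eq_add_of_le' hp
    rw [trace_weitzenbockForm_succ (by omega) hTens, hs, Nat.add_sub_cancel]
  · have : FiniteDimensional ℝ (TangentSpace (𝓡 n) x) := e.toBasis.finiteDimensional_of_finite
    have hdim : Module.finrank ℝ (TangentSpace (𝓡 n) x) = n := by
      rw [Module.finrank_eq_card_basis e.toBasis, Fintype.card_fin]
    -- For n < 2 there are no pairs i < j and the curvature vanishes, so both sides are zero
    -- although the exponent n - 2 is negative.
    rcases lt_or_ge n 2 with hn | hn
    · have : Subsingleton (Fin n) := Fin.subsingleton_iff_le_one.2 (by omega)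
      have h0 (i : Fin n) : Finset.Ioi i = ∅ :=
        Finset.eq_empty_of_forall_notMem fun j hj ↦
          (Finset.mem_Ioi.1 hj).ne (Subsingleton.elim _ _)
      have h1 (i j : Fin n) (w : TangentSpace (𝓡 n) x) : T (e i) (e j) w = 0 := by
        obtain rfl := Subsingleton.elim i j
        exact hTens.apply_self _ _
      rw [hs]
      simp [weitzenbock, h0, h1]
    · rw [trace_exteriorForms _ _ hW, hdim, Finset.sum_range_succ', trace_weitzenbockForm_zero,
        add_zero, hs, ← sum_choose_sub_one hn]
      exact Finset.sum_congr rfl fun p _ ↦ trace_weitzenbockForm_succ hn hTens e p
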